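/- Low-density limit of the direct correlation functions of the Möbius (cluster-expansion) functional. Setting. Let $\mathcal L$ be a set of nodes (finite or infinite) and consider a lattice gas of $p$ species on $\mathcal L$. A site is a pair $x=(i,\mathbf s)$ of a species and a node, and $X$ is the set of all sites. The particles interact through a symmetric pair potential $\phi(x,y)\in(-\infty,+\infty]$ (in units of $kT$; $\phi(x,x)$ is the energy of two particles of the same species on the same node, $+\infty$ meaning site exclusion), which is stable on every finite $\Lambda\subset X$: there is $B$ such that $\sum_{k<l}\phi(x_k,x_l)\ge -BN$ for all $N$ and $x_1,\dots,x_N\in\Lambda$ (this is automatic for site-excluding and for non-negative potentials). Let $f(x,y)=e^{-\phi(x,y)}-1$ be the Mayer function. A cluster is a subset $\mathcal C\subset X$ (equivalently a $p$-tuple $(\mathcal C_1,\dots,\mathcal C_p)$ of subsets of $\mathcal L$); $\boldsymbol{\mathcal L}=X$ is the full cluster. Density profiles are finitely supported $\rho: X\to[0,\infty)$. For a finite cluster $\Lambda$ put $\Xi_\Lambda(u)=\sum_{N\ge0}\frac1{N!}\sum_{x_1,\dots,x_N\in\Lambda}e^{\sum_k u(x_k)-\sum_{k<l}\phi(x_k,x_l)}$.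 The exact free-energy functional of the system restricted to a cluster $\mathcal C$ is $\mathcal F_{\mathcal C}[\rho]=\sup_u\bigl(\sum_{x\in\Lambda}\rho(x)u(x)-\ln\Xi_\Lambda(u)\bigr)$ with $\Lambda=\mathcal C\cap\operatorname{supp}\rho$, and its excess part is $\mathcal F^{\rm ex}_{\mathcal C}[\rho]=\mathcal F_{\mathcal C}[\rho]-\sum_{x\in\Lambda}\rho(x)(\ln\rho(x)-1)$. Let $\mathcal W_{\max}$ be a set of clusters not containing $\boldsymbol{\mathcal L}$, and let $\mathcal W$ be the poset (under inclusion) consisting of $\boldsymbol{\mathcal L}$ and all non-empty intersections of clusters of $\mathcal W_{\max}$; assume that $\mathcal W$ is locally finite (all its intervals are finite) and let $\mu_{\mathcal W}$ be its Möbius function. The excess part of the approximate functional is $$\mathcal F^{\rm ex}_{\rm app}[\rho]=\sum_{\mathcal C\in\mathcal W\setminus\{\boldsymbol{\mathcal L}\}}[-\mu_{\mathcal W}(\mathcal C,\boldsymbol{\mathcal L})]\,\mathcal F^{\rm ex}_{\mathcal C}[\rho].$$ The exact and approximate direct correlation functions are $c^{(2)}(x,y)=-\partial^2\mathcal F^{\rm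 ex}_{\boldsymbol{\mathcal L}}/\partial\rho(x)\partial\rho(y)$, $c^{(3)}(x,y,z)=-\partial^3\mathcal F^{\rm ex}_{\boldsymbol{\mathcal L}}/\partial\rho(x)\partial\rho(y)\partial\rho(z)$, and $c^{(2)}_{\rm app}$, $c^{(3)}_{\rm app}$, defined in the same way from $\mathcal F^{\rm ex}_{\rm app}$. Here $\rho\to0$ means, for an arbitrary finite $\Lambda\subset X$ containing the sites involved, that $\rho\to0$ through profiles that are positive on $\Lambda$ and zero outside; sites among $x,y,z$ may coincide. Say that a set $S$ of sites is covered if $S\subset\mathcal D$ for some $\mathcal D\in\mathcal W_{\max}$. Theorem. (1) For every finite $\Lambda$, near zero density, $\mathcal F^{\rm ex}_{\boldsymbol{\mathcal L}}$ and $\mathcal F^{\rm ex}_{\rm app}$ are three times continuously differentiable in the densities on $\Lambda$. As $\rho\to0$, $c^{(2)}(x,y)=f(x,y)\bigl[1+\sum_{z}f(x,z)\rho(z)f(z,y)\bigr]+o(\rho)$ and $c^{(3)}(x,y,z)\to f(x,y)f(y,z)f(z,x)$. (2) As $\rho\to0$, $c^{(2)}_{\rm app}(x,y)$ tends to $f(x,y)$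 if $\{x,y\}$ is covered and to $0$ otherwise; $c^{(3)}_{\rm app}(x,y,z)$ tends to $f(x,y)f(y,z)f(z,x)$ if $\{x,y,z\}$ is covered and to $0$ otherwise. Consequently $c^{(2)}_{\rm app}-c^{(2)}\to0$ for all pairs of sites if and only if every pair with $f(x,y)\ne0$ is covered, and $c^{(3)}_{\rm app}-c^{(3)}\to0$ for all triples of sites if and only if every triple with $f(x,y)f(y,z)f(z,x)\ne0$ is covered. (3) Let $x,y\in\Lambda$. If $\{x,y\}$ is covered or $f(x,y)=0$, and every $\{x,y,z\}$, $z\in\Lambda$, with $f(x,y)f(y,z)f(z,x)\ne0$ is covered, then $c^{(2)}_{\rm app}(x,y)=c^{(2)}(x,y)+o(\rho)$ as $\rho\to0$ through profiles on $\Lambda$. (4) Call a cluster a 0D cavity if any two particles placed at distinct sites of it interact ($f\neq0$). If $\boldsymbol{\mathcal L}$ itself is not a 0D cavity and $\mathcal W_{\max}$ is the set of maximal 0D cavities (with $\mathcal W$ locally finite), then for all sites $c^{(2)}_{\rm app}(x,y)=c^{(2)}(x,y)+o(\rho)$ and $c^{(3)}_{\rm app}(x,y,z)-c^{(3)}(x,y,z)\to0$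 as $\rho\to0$: the density expansions of the pair and triplet functions are recovered to first and zeroth order, respectively. -/

import Mathlib

open Set Filter Topology Asymptotics

/-!  Throughout, `X` is the set of pairs (species, node).  A multicomponent cluster
`(C₁, …, C_p)` of subsets of the lattice is the set of pairs `(i, s)` with `s ∈ C_i`;
componentwise inclusion and intersection become inclusion and intersection of subsets of `X`,
and the full lattice cluster is `Set.univ`. -/

noncomputable section

/-- A symmetric pair potential (in units of `kT`) with values in `(-∞, +∞]` that is stable on
every finite set of sites.  The value at `(x, x)` is the energy of two particles of the same
species on the same node; `⊤` there means site exclusion.  Stability is automatic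
for non-negative potentials and for site-excluding ones. -/
structure PairPotential (X : Type*) where
  energy : X → X → WithTop ℝ
  symm : ∀ x y, energy x y = energy y x
  stable : ∀ Λ : Finset X, ∃ B : ℝ, ∀ (N : ℕ) (x : Fin N → X), (∀ i, x i ∈ Λ) →
    ((-(B * N) : ℝ) : WithTop ℝ) ≤ ∑ i, ∑ j ∈ Finset.Ioi i, energy (x i) (x j)

/-- `e ↦ exp (-e)`, with `exp (-∞) = 0`; the Boltzmann factor of the energy `e`. -/
def boltzmann : WithTop ℝ → ℝ :=
  WithTop.recTopCoe 0 (fun r => Real.exp (-r))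

namespace PairPotential

variable {X : Type*} (V : PairPotential X)

/-- The Mayer function `exp (-V) - 1`. -/
def mayer (x y : X) : ℝ := boltzmann (V.energy x y) - 1

/-- The grand canonical partition function of the system confined to the finite cluster `Λ`,
at the site-dependent (intrinsic) chemical potential `u`, in units of `kT`:
`∑_N 1/N! ∑_{x₁, …, x_N ∈ Λ} exp (∑ u(x_i) - ∑_{i<j} V(x_i, x_j))`. -/
def partitionFunction (Λ : Finset X) (u : X → ℝ) : ℝ :=
  ∑' N : ℕ, (1 / (N.factorial : ℝ)) * ∑ x : Fin N → Λ,
    Real.exp (∑ i, u (x i)) * ∏ i, ∏ j ∈ Finset.Ioi i, boltzmann (V.energy (x i) (x j))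

/-- The exact intrinsic free energy of the system confined to the finite cluster `Λ`,
as a functional of the density: the Legendre transform of the logarithm of the partition
function. -/
def finiteFreeEnergy (Λ : Finset X) (ρ : X → ℝ) : ℝ :=
  ⨆ u : X → ℝ, (∑ x ∈ Λ, ρ x * u x - Real.log (V.partitionFunction Λ u))

open Classical in
/-- The sites of the cluster `C` at which the finitely supported profile `ρ` does not vanish. -/
def occupiedSites (C : Set X) (ρ : X →₀ ℝ) : Finset X := {x ∈ ρ.support | x ∈ C}

/-- The exact free-energy functional of the system restricted to an arbitrary cluster `C`, on
finitely supported density profiles (sites of zero density do not contribute). -/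
def freeEnergy (C : Set X) (ρ : X →₀ ℝ) : ℝ := V.finiteFreeEnergy (occupiedSites C ρ) ρ

/-- The free-energy functional of the ideal gas on the cluster `C`. -/
def idealFreeEnergy (C : Set X) (ρ : X →₀ ℝ) : ℝ :=
  ∑ x ∈ occupiedSites C ρ, ρ x * (Real.log (ρ x) - 1)

/-- The exact excess (over ideal) free-energy functional on the cluster `C`. -/
def excessFreeEnergy (C : Set X) (ρ : X →₀ ℝ) : ℝ := V.freeEnergy C ρ - idealFreeEnergy C ρ

/-- A 0D cavity: two particles placed at any two (distinct) sites of it interact. -/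
def IsZeroDCavity (C : Set X) : Prop := C.Pairwise fun x y => V.mayer x y ≠ 0

/-- For potentials with on-site interaction, this says that any two particles in the cavity,
even of the same species on the same node, interact. -/
theorem isZeroDCavity_iff (h : ∀ x, V.mayer x x ≠ 0) (C : Set X) :
    V.IsZeroDCavity C ↔ ∀ x ∈ C, ∀ y ∈ C, V.mayer x y ≠ 0 := by
  refine ⟨fun hC x hx y hy => ?_, fun hC x hx y hy _ => hC x hx y hy⟩
  by_cases hxy : x = y
  · exact hxy ▸ h x
  · exact hC hx hy hxy

/-- The set of maximal 0D cavities. -/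
def maximalZeroDCavities : Set (Set X) := {C | Maximal V.IsZeroDCavity C}

end PairPotential

section Clusters

variable {X : Type*}

/-- The cluster poset generated by `Wmax`: the full cluster and all non-empty intersections of
(non-empty families of) elements of `Wmax`, ordered by inclusion. -/
def ClusterPoset (Wmax : Set (Set X)) : Type _ :=
  {C : Set X // C = univ ∨ (C.Nonempty ∧ ∃ S ⊆ Wmax, S.Nonempty ∧ C = ⋂₀ S)}

instance (Wmax : Set (Set X)) : PartialOrder (ClusterPoset Wmax) :=
  inferInstanceAs (PartialOrder (Subtype _))

instance (Wmax : Set (Set X)) : OrderTop (ClusterPoset Wmax) where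
  top := ⟨univ, Or.inl rfl⟩
  le_top C := subset_univ C.1

open Classical in
/-- The excess part of the approximate functional,
`∑_{C ∈ W, C ≠ 𝓛} [-μ_W(C, 𝓛)] F_C^ex[ρ]`, with `μ_W` the Möbius function of the cluster poset.
If `W` is locally finite, only finitely many clusters meet the support of `ρ`, so that the
sum is finite. -/
def approxExcessFreeEnergy (V : PairPotential X) (Wmax : Set (Set X))
    [LocallyFiniteOrder (ClusterPoset Wmax)] (ρ : X →₀ ℝ) : ℝ :=
  ∑ᶠ (C : ClusterPoset Wmax) (_ : C < ⊤),
    (-(IncidenceAlgebra.mu ℤ C ⊤ : ℤ) : ℝ) * V.excessFreeEnergy C.1 ρ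

end Clusters

section Correlations

variable {X : Type*}

/-- The functional derivative `δG/δρ(x)` at `ρ`, i.e. the partial derivative in `ρ(x)`. -/
def functionalDeriv (x : X) (G : (X →₀ ℝ) → ℝ) (ρ : X →₀ ℝ) : ℝ :=
  deriv (fun t => G (ρ.update x t)) (ρ x)

/-- The pair direct correlation function `-δ²G/δρ(x)δρ(y)` of the excess functional `G`. -/
def pairDCF (G : (X →₀ ℝ) → ℝ) (x y : X) (ρ : X →₀ ℝ) : ℝ :=
  -functionalDeriv x (functionalDeriv y G) ρ

/-- The triplet direct correlation function `-δ³G/δρ(x)δρ(y)δρ(z)`. -/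
def tripletDCF (G : (X →₀ ℝ) → ℝ) (x y z : X) (ρ : X →₀ ℝ) : ℝ :=
  -functionalDeriv x (functionalDeriv y (functionalDeriv z G)) ρ

/-- The density profile with values `v` on `Λ` and `0` elsewhere. -/
def profile (Λ : Finset X) (v : Λ → ℝ) : X →₀ ℝ := Finsupp.indicator Λ fun x hx => v ⟨x, hx⟩

/-- The low-density limit `ρ → 0` through profiles which are positive exactly on `Λ`. -/
def lowDensity (Λ : Finset X) : Filter (Λ → ℝ) := 𝓝[{v | ∀ x, 0 < v x}] 0

/-- Near zero density on `Λ`, the functional `G` is three times continuously differentiable in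
the densities of the sites of `Λ`. -/
def SmoothAtLowDensity (G : (X →₀ ℝ) → ℝ) (Λ : Finset X) : Prop :=
  ∀ᶠ v in lowDensity Λ, ContDiffAt ℝ 3 (fun w => G (profile Λ w)) v

/-- Some cluster in `Wmax` contains `S`. -/
def Covered (Wmax : Set (Set X)) (S : Set X) : Prop := ∃ D ∈ Wmax, S ⊆ D

instance (Wmax : Set (Set X)) (S : Set X) : Decidable (Covered Wmax S) := Classical.dec _

/-- `f(x,y) [1 + ∑_z f(x,z) ρ(z) f(z,y)]`, the expansion of the pair direct correlation function
up to first order in the density, for a profile `v` on `Λ`. -/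
def PairPotential.pairExpansion (V : PairPotential X) (Λ : Finset X) (x y : X) (v : Λ → ℝ) : ℝ :=
  V.mayer x y * (1 + ∑ z : Λ, V.mayer x z * v z * V.mayer z y)

/-- The product of Mayer functions around a triangle. -/
def PairPotential.mayerTriangle (V : PairPotential X) (x y z : X) : ℝ :=
  V.mayer x y * V.mayer y z * V.mayer z x

end Correlations

end

/-! On a finite set of sites, stability makes the partition function an entire power series in the
activities `z = e^u`, and its derivatives at `z = 0` are products of Boltzmann factors. The density
at `x` is `z_x ∂_xΞ / Ξ = z_x exp (logDensityRatio b x z)`. This map has derivative the identity at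
zero, so it has an analytic local inverse `Z`. Convexity of tilted partition functions shows that
the Legendre supremum is attained at `u = ln Z(ρ)`. The logarithms of the densities then cancel
against the ideal part, and the excess free energy becomes `excessOfActivity`, a function analytic
at `ρ = 0` itself.

The first derivative of this function in `ρ(y)` is `-logDensityRatio b y (Z ρ)`. Differentiating
once and twice more at zero gives `-f` and `-fff`: the chain products `ff` produced by the partition
function cancel against those produced by inverting `Z`, and only the triangle survives
(`partialDeriv_two_ratio_activity_zero`).

The functional of a cluster `C` sees only the densities in `C`, so a derivative at zero along a set
`S` of two or three sites is the full one if `S ⊆ C` and vanishes otherwise. In the Möbius sum, the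
coefficient of this derivative is therefore the sum of `-μ(C, ⊤)` over the clusters `C < ⊤`
containing `S`. If `S` is covered, these form an interval `[M, ⊤)` and the sum is `1`; otherwise
there are none (`sum_mu_of_subset`). Comparing the two Taylor expansions gives all the limits. For
0D cavities, a pair or triple with non-zero Mayer product is itself a cavity, and by Zorn it lies in
a maximal one. -/

noncomputable section

/-! ### The partition function as an entire function of the activities. -/

section GrandCanonical

open scoped ContDiff

variable {ι : Type*} [Fintype ι] (b : ι → ι → ℝ)

/-- The Boltzmann weight of a configuration, for pair weights `b`. -/
def pairWeight {N : ℕ} (x : Fin N → ι) : ℝ := ∏ i, ∏ j ∈ Finset.Ioi i, b (x i) (x j)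

/-- The power series, in the activities, of the grand canonical partition function. -/
def grandSeries : FormalMultilinearSeries ℝ (ι → ℝ) ℝ := fun N =>
  (1 / (N.factorial : ℝ)) • ∑ x : Fin N → ι, pairWeight b x •
    (ContinuousMultilinearMap.mkPiAlgebra ℝ (Fin N) ℝ).compContinuousLinearMap
      fun i => ContinuousLinearMap.proj (R := ℝ) (φ := fun _ : ι => ℝ) (x i)

/-- The grand canonical partition function as a function of the activities. -/
def grandSum (z : ι → ℝ) : ℝ := (grandSeries b).sum z

lemma grandSeries_apply {N : ℕ} (m : Fin N → ι → ℝ) : grandSeries b N m =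
    (1 / (N.factorial : ℝ)) * ∑ x : Fin N → ι, pairWeight b x * ∏ i, m i (x i) := by
  simp [grandSeries]

lemma grandSum_eq (z : ι → ℝ) : grandSum b z = ∑' N : ℕ, (1 / (N.factorial : ℝ)) *
    ∑ x : Fin N → ι, pairWeight b x * ∏ i, z (x i) := by
  simp [grandSum, FormalMultilinearSeries.sum, grandSeries_apply]

/-- Pair weights that are non-negative, symmetric and stable. -/
structure StableWeight : Prop where
  nonneg : ∀ x y, 0 ≤ b x y
  symm : ∀ x y, b x y = b y x
  stable : ∃ B : ℝ, ∀ (N : ℕ) (x : Fin N → ι), pairWeight b x ≤ Real.exp (B * N)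

namespace StableWeight

variable {b} (hb : StableWeight b)
include hb

omit [Fintype ι] in
lemma pairWeight_nonneg {N : ℕ} (x : Fin N → ι) : 0 ≤ pairWeight b x :=
  Finset.prod_nonneg fun _ _ => Finset.prod_nonneg fun _ _ => hb.nonneg _ _

/-- There are `(card ι) ^ N` configurations of `N` particles, each of weight at most `e^{BN}`, hence
`K = card ι * e^B`. The factor `1 / N!` then beats every radius. -/
lemma exists_term_bound : ∃ K : ℝ, 0 ≤ K ∧ ∀ (N : ℕ) (m : Fin N → ι → ℝ),
    (1 / (N.factorial : ℝ)) * ∑ x : Fin N → ι, ‖pairWeight b x * ∏ i, m i (x i)‖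
      ≤ K ^ N / N.factorial * ∏ i, ‖m i‖ := by
  obtain ⟨B, hB⟩ := hb.stable
  refine ⟨Fintype.card ι * Real.exp B, by positivity, fun N m => ?_⟩
  have h : ∑ x : Fin N → ι, ‖pairWeight b x * ∏ i, m i (x i)‖ ≤
      ∑ _x : Fin N → ι, Real.exp (B * N) * ∏ i, ‖m i‖ := by
    refine Finset.sum_le_sum fun x _ => ?_
    rw [norm_mul, Real.norm_of_nonneg (hb.pairWeight_nonneg x), norm_prod]
    gcongr
    · exact hB N x
    · exact norm_le_pi_norm _ _
  rw [Finset.sum_const, Finset.card_univ, Fintype.card_fun, Fintype.card_fin, nsmul_eq_mul] at h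
  calc _ ≤ (1 / (N.factorial : ℝ)) *
        ((Fintype.card ι ^ N : ℕ) * (Real.exp (B * N) * ∏ i, ‖m i‖)) := by gcongr
    _ = _ := by
      rw [mul_pow, ← Real.exp_nat_mul, mul_comm B]
      push_cast
      ring

lemma radius_eq_top : (grandSeries b).radius = ⊤ := by
  obtain ⟨K, hK, h⟩ := hb.exists_term_bound
  refine FormalMultilinearSeries.radius_eq_top_of_summable_norm _ fun r => ?_
  refine Summable.of_nonneg_of_le (fun n => by positivity) (fun n => ?_)
    (Real.summable_pow_div_factorial (K * r))
  rw [mul_pow, mul_div_right_comm]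
  gcongr
  refine ContinuousMultilinearMap.opNorm_le_bound (by positivity) fun m => ?_
  rw [grandSeries_apply, norm_mul, Real.norm_of_nonneg (by positivity)]
  exact le_trans (by gcongr; exact norm_sum_le _ _) (h n m)

lemma hasFPowerSeriesOnBall : HasFPowerSeriesOnBall (grandSum b) (grandSeries b) 0 ⊤ := by
  have := (grandSeries b).hasFPowerSeriesOnBall (by simp [hb.radius_eq_top])
  rwa [hb.radius_eq_top] at this

lemma contDiff_grandSum : ContDiff ℝ ω (grandSum b) := by
  rw [contDiff_iff_contDiffAt]
  exact fun z => (hb.hasFPowerSeriesOnBall.analyticAt_of_mem (by simp)).contDiffAt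

lemma summable_term (z : ι → ℝ) : Summable fun N : ℕ => (1 / (N.factorial : ℝ)) *
    ∑ x : Fin N → ι, pairWeight b x * ∏ i, z (x i) := by
  obtain ⟨K, hK, h⟩ := hb.exists_term_bound
  refine Summable.of_norm_bounded (Real.summable_pow_div_factorial (K * ‖z‖)) fun N => ?_
  rw [norm_mul, Real.norm_of_nonneg (by positivity)]
  refine le_trans (by gcongr; exact norm_sum_le _ _) ((h N fun _ => z).trans_eq ?_)
  rw [Finset.prod_const, Finset.card_univ, Fintype.card_fin, mul_pow]
  ring

omit hb in
lemma grandSum_zero : grandSum b 0 = 1 := by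
  rw [grandSum_eq, tsum_eq_single 0]
  · simp [pairWeight]
  · intro N hN
    simp [hN]

lemma one_le_grandSum {z : ι → ℝ} (hz : ∀ x, 0 ≤ z x) : 1 ≤ grandSum b z := by
  rw [grandSum_eq]
  refine le_trans (by simp [pairWeight]) ((hb.summable_term z).le_tsum 0 fun N _ => ?_)
  exact mul_nonneg (by positivity) (Finset.sum_nonneg fun x _ =>
    mul_nonneg (hb.pairWeight_nonneg x) (Finset.prod_nonneg fun i _ => hz _))

/-- A tilted partition function is convex in the strength of the tilt. -/
lemma convexOn_tilt {z : ι → ℝ} (hz : ∀ x, 0 ≤ z x) (h : ι → ℝ) (m : ℝ) :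
    ConvexOn ℝ univ fun t : ℝ =>
      Real.exp (-(t * m)) * grandSum b fun x => z x * Real.exp (t * h x) := by
  -- Once `e^{-tm}` is absorbed, each configuration contributes a non-negative constant times an
  -- exponential of a linear function of `t`, so convexity holds term by term.
  have hterm : ∀ (t : ℝ) (N : ℕ), Real.exp (-(t * m)) * ((1 / (N.factorial : ℝ)) *
      ∑ x : Fin N → ι, pairWeight b x * ∏ i, (z (x i) * Real.exp (t * h (x i)))) =
      (1 / (N.factorial : ℝ)) * ∑ x : Fin N → ι, pairWeight b x * (∏ i, z (x i)) *
        Real.exp (t * (∑ i, h (x i) - m)) := by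
    intro t N
    rw [mul_left_comm, Finset.mul_sum]
    congr 1
    refine Finset.sum_congr rfl fun x _ => ?_
    rw [Finset.prod_mul_distrib, ← Real.exp_sum, mul_sub, Finset.mul_sum, sub_eq_add_neg,
      Real.exp_add]
    ring
  have key : ∀ t : ℝ, Real.exp (-(t * m)) * grandSum b (fun x => z x * Real.exp (t * h x)) =
      ∑' N : ℕ, (1 / (N.factorial : ℝ)) * ∑ x : Fin N → ι, pairWeight b x * (∏ i, z (x i)) *
        Real.exp (t * (∑ i, h (x i) - m)) := fun t => by
    rw [grandSum_eq, ← tsum_mul_left]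
    exact tsum_congr (hterm t)
  have hs : ∀ t : ℝ, Summable fun N : ℕ => (1 / (N.factorial : ℝ)) * ∑ x : Fin N → ι,
      pairWeight b x * (∏ i, z (x i)) * Real.exp (t * (∑ i, h (x i) - m)) := fun t =>
    ((hb.summable_term fun x => z x * Real.exp (t * h x)).mul_left
      (Real.exp (-(t * m)))).congr (hterm t)
  refine ⟨convex_univ, fun s _ t _ α β hα hβ hαβ => ?_⟩
  simp only [key, smul_eq_mul]
  rw [← tsum_mul_left, ← tsum_mul_left, ← ((hs s).mul_left α).tsum_add ((hs t).mul_left β)]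
  refine (hs _).tsum_le_tsum (fun N => ?_) (((hs s).mul_left α).add ((hs t).mul_left β))
  rw [mul_left_comm α, mul_left_comm β, ← mul_add, Finset.mul_sum _ _ α, Finset.mul_sum _ _ β,
    ← Finset.sum_add_distrib]
  refine mul_le_mul_of_nonneg_left (Finset.sum_le_sum fun x _ => ?_) (by positivity)
  have hw : 0 ≤ pairWeight b x * ∏ i, z (x i) :=
    mul_nonneg (hb.pairWeight_nonneg x) (Finset.prod_nonneg fun i _ => hz _)
  have hc := convexOn_exp.2 (mem_univ (s * (∑ i, h (x i) - m)))
    (mem_univ (t * (∑ i, h (x i) - m))) hα hβ hαβ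
  simp only [smul_eq_mul] at hc
  calc _ = (pairWeight b x * ∏ i, z (x i)) * Real.exp (α * (s * (∑ i, h (x i) - m)) +
        β * (t * (∑ i, h (x i) - m))) := by ring_nf
    _ ≤ (pairWeight b x * ∏ i, z (x i)) * (α * Real.exp (s * (∑ i, h (x i) - m)) +
        β * Real.exp (t * (∑ i, h (x i) - m))) := mul_le_mul_of_nonneg_left hc hw
    _ = _ := by ring

end StableWeight

end GrandCanonical


/-! ### Calculus of partial derivatives of analytic functions. -/

section PartialDerivatives

open scoped ContDiff

variable {ι κ : Type*} [Fintype ι] [DecidableEq ι] [Fintype κ] [DecidableEq κ]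

/-- The partial derivative of `g` in the coordinate `y`. -/
def partialDeriv (y : ι) (g : (ι → ℝ) → ℝ) (v : ι → ℝ) : ℝ := fderiv ℝ g v (Pi.single y 1)

variable {g h : (ι → ℝ) → ℝ} {v : ι → ℝ} (y : ι)

omit [Fintype ι] in
lemma Filter.EventuallyEq.partialDeriv (hgh : g =ᶠ[𝓝 v] h) :
    partialDeriv y g =ᶠ[𝓝 v] partialDeriv y h :=
  hgh.fderiv.fun_comp fun L => L (Pi.single y 1)

/-- Working at regularity `ω` means that no smoothness is lost under repeated differentiation. -/
lemma ContDiffAt.partialDeriv (hg : ContDiffAt ℝ ω g v) : ContDiffAt ℝ ω (partialDeriv y g) v :=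
  (hg.fderiv_right (m := ω) le_rfl).clm_apply contDiffAt_const

lemma ContDiffAt.eventually_omega {E F : Type*} [NormedAddCommGroup E] [NormedSpace ℝ E]
    [NormedAddCommGroup F] [NormedSpace ℝ F] {f : E → F} {a : E} (hf : ContDiffAt ℝ ω f a) :
    ∀ᶠ w in 𝓝 a, ContDiffAt ℝ ω f w := hf.eventually (by simp)

lemma ContDiffAt.differentiableAt_omega {E F : Type*} [NormedAddCommGroup E] [NormedSpace ℝ E]
    [NormedAddCommGroup F] [NormedSpace ℝ F] {f : E → F} {a : E} (hf : ContDiffAt ℝ ω f a) :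
    DifferentiableAt ℝ f a := hf.differentiableAt (by simp)

omit [Fintype ι] in
lemma partialDeriv_const (c : ℝ) : partialDeriv y (fun _ => c) v = 0 := by
  simp [partialDeriv]

omit [Fintype ι] in
lemma partialDeriv_coord (x : ι) :
    partialDeriv y (fun v => v x) v = if x = y then 1 else 0 := by
  have : HasFDerivAt (fun v : ι → ℝ => v x)
    (ContinuousLinearMap.proj (R := ℝ) (φ := fun _ : ι => ℝ) x) v :=
    (ContinuousLinearMap.proj (R := ℝ) (φ := fun _ : ι => ℝ) x).hasFDerivAt
  simp [partialDeriv, this.fderiv, Pi.single_apply]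

variable (hg : DifferentiableAt ℝ g v) (hh : DifferentiableAt ℝ h v)

include hg hh in
lemma partialDeriv_sub :
    partialDeriv y (fun v => g v - h v) v = partialDeriv y g v - partialDeriv y h v := by
  simp [partialDeriv, fderiv_fun_sub hg hh]

include hg hh in
lemma partialDeriv_mul : partialDeriv y (fun v => g v * h v) v =
    partialDeriv y g v * h v + g v * partialDeriv y h v := by
  simp [partialDeriv, fderiv_fun_mul hg hh]
  ring

omit [DecidableEq κ] [Fintype κ] in
lemma partialDeriv_sum {g : κ → (ι → ℝ) → ℝ} (s : Finset κ)
    (hg : ∀ i ∈ s, DifferentiableAt ℝ (g i) v) :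
    partialDeriv y (fun v => ∑ i ∈ s, g i v) v = ∑ i ∈ s, partialDeriv y (g i) v := by
  simp [partialDeriv, fderiv_fun_sum hg]

lemma partialDeriv_neg : partialDeriv y (fun v => -g v) v = -partialDeriv y g v := by
  simp [partialDeriv, fderiv_fun_neg]

include hg in
lemma partialDeriv_exp :
    partialDeriv y (fun v => Real.exp (g v)) v = Real.exp (g v) * partialDeriv y g v := by
  simp [partialDeriv, fderiv_exp hg]

include hg in
lemma partialDeriv_log (h0 : g v ≠ 0) :
    partialDeriv y (fun v => Real.log (g v)) v = (g v)⁻¹ * partialDeriv y g v := by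
  simp [partialDeriv, fderiv.log hg h0]

include hg in
lemma partialDeriv_inv (h0 : g v ≠ 0) :
    partialDeriv y (fun v => (g v)⁻¹) v = -partialDeriv y g v / g v ^ 2 := by
  have := (hasDerivAt_inv h0).comp_hasFDerivAt v hg.hasFDerivAt
  simp only [partialDeriv]
  rw [show (fun v => (g v)⁻¹) = Inv.inv ∘ g from rfl, this.fderiv]
  simp
  ring

lemma fderiv_apply_eq_sum_partialDeriv (g : (ι → ℝ) → ℝ) (v w : ι → ℝ) :
    fderiv ℝ g v w = ∑ i, w i * partialDeriv i g v := by
  conv_lhs => rw [← Finset.univ_sum_single w, map_sum]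
  refine Finset.sum_congr rfl fun i _ => ?_
  rw [partialDeriv, ← smul_eq_mul, ← map_smul, ← Pi.single_smul, smul_eq_mul, mul_one]

lemma partialDeriv_comp {Z : (κ → ℝ) → ι → ℝ} {v : κ → ℝ} (y : κ)
    (hg : DifferentiableAt ℝ g (Z v)) (hZ : DifferentiableAt ℝ Z v) :
    partialDeriv y (fun v => g (Z v)) v =
      ∑ w, partialDeriv w g (Z v) * partialDeriv y (fun v => Z v w) v := by
  simp only [partialDeriv]
  rw [fderiv_fun_comp v hg hZ, ContinuousLinearMap.comp_apply,
    fderiv_apply_eq_sum_partialDeriv g]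
  refine Finset.sum_congr rfl fun w _ => ?_
  rw [mul_comm, partialDeriv, (hasFDerivAt_pi'.1 hZ.hasFDerivAt w).fderiv]
  rfl

include hg in
lemma deriv_update_eq_partialDeriv :
    deriv (fun t => g (Function.update v y t)) (v y) = partialDeriv y g v := by
  have h1 := hasDerivAt_update v y (v y)
  have h2 : HasFDerivAt g (fderiv ℝ g v) (Function.update v y (v y)) := by
    rw [Function.update_eq_self]; exact hg.hasFDerivAt
  exact (h2.comp_hasDerivAt _ h1).deriv

lemma partialDeriv_iteratedFDeriv (hg : ContDiff ℝ ω g) {n : ℕ} (m : Fin n → ι → ℝ) :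
    partialDeriv y (fun v => iteratedFDeriv ℝ n g v m) v =
      iteratedFDeriv ℝ (n + 1) g v (Fin.cons (Pi.single y 1) m) := by
  have hd : DifferentiableAt ℝ (iteratedFDeriv ℝ n g) v :=
    (hg.differentiable_iteratedFDeriv (by exact_mod_cast WithTop.coe_lt_top _)).differentiableAt
  rw [partialDeriv, fderiv_continuousMultilinear_apply_const_apply hd, iteratedFDeriv_succ_apply_left]
  simp

end PartialDerivatives

/-! ### Derivatives of the partition function at zero activity. -/

section GrandCanonical

open scoped ContDiff

variable {ι : Type*} [Fintype ι] [DecidableEq ι] {b : ι → ι → ℝ}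

lemma grandSeries_single {N : ℕ} (a : Fin N → ι) :
    grandSeries b N (fun i => Pi.single (a i) 1) = (1 / (N.factorial : ℝ)) * pairWeight b a := by
  rw [grandSeries_apply, Finset.sum_eq_single a]
  · simp
  · intro x _ hx
    obtain ⟨i, hi⟩ := Function.ne_iff.1 hx
    rw [Finset.prod_eq_zero (Finset.mem_univ i) (by simp [hi]), mul_zero]
  · simp

namespace StableWeight

variable (hb : StableWeight b)
include hb

/-- The iterated derivative of a power series is its coefficient summed over all orderings of the
arguments; for a symmetric weight these `N!` equal terms cancel the `1 / N!` of the series. -/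
lemma iteratedFDeriv_grandSum {N : ℕ} (a : Fin N → ι)
    (ha : ∀ σ : Equiv.Perm (Fin N), pairWeight b (fun i => a (σ i)) = pairWeight b a) :
    iteratedFDeriv ℝ N (grandSum b) 0 (fun i => Pi.single (a i) 1) = pairWeight b a := by
  rw [hb.hasFPowerSeriesOnBall.iteratedFDeriv_eq_sum_of_completeSpace]
  simp only [grandSeries_single, ha]
  rw [Finset.sum_const, Finset.card_univ, Fintype.card_perm, Fintype.card_fin, nsmul_eq_mul]
  have : (N.factorial : ℝ) ≠ 0 := by positivity
  field_simp

omit [Fintype ι] [DecidableEq ι] in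
lemma pairWeight_perm_two (a : Fin 2 → ι) (σ : Equiv.Perm (Fin 2)) :
    pairWeight b (fun i => a (σ i)) = pairWeight b a := by
  have h01 : σ 0 ≠ σ 1 := by simp
  have e0 : Finset.Ioi (0 : Fin 2) = {1} := by decide
  have e1 : Finset.Ioi (1 : Fin 2) = ∅ := by decide
  simp only [pairWeight, Fin.prod_univ_two, e0, e1, Finset.prod_singleton, Finset.prod_empty]
  generalize σ 0 = i at *
  generalize σ 1 = j at *
  clear e0 e1
  have h10 := hb.symm (a 1) (a 0)
  fin_cases i <;> fin_cases j <;> simp_all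

omit [Fintype ι] [DecidableEq ι] in
lemma pairWeight_perm_three (a : Fin 3 → ι) (σ : Equiv.Perm (Fin 3)) :
    pairWeight b (fun i => a (σ i)) = pairWeight b a := by
  have h01 : σ 0 ≠ σ 1 := by simp
  have h02 : σ 0 ≠ σ 2 := by simp
  have h12 : σ 1 ≠ σ 2 := by simp
  have e0 : Finset.Ioi (0 : Fin 3) = {1, 2} := by decide
  have e1 : Finset.Ioi (1 : Fin 3) = {2} := by decide
  have e2 : Finset.Ioi (2 : Fin 3) = ∅ := by decide
  have h (f : Fin 3 → ℝ) : ∏ j ∈ ({1, 2} : Finset (Fin 3)), f j = f 1 * f 2 :=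
    Finset.prod_pair (by decide)
  simp only [pairWeight, Fin.prod_univ_three, e0, e1, e2, Finset.prod_singleton,
    Finset.prod_empty, h]
  generalize σ 0 = i at *
  generalize σ 1 = j at *
  generalize σ 2 = k at *
  clear e0 e1 e2 h
  have h10 := hb.symm (a 1) (a 0)
  have h20 := hb.symm (a 2) (a 0)
  have h21 := hb.symm (a 2) (a 1)
  -- The inequalities between `i`, `j`, `k` discard all cases except the six permutations.
  fin_cases i <;> fin_cases j <;> fin_cases k <;>
    simp_all [-mul_eq_mul_left_iff, -mul_eq_mul_right_iff] <;> ring1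

omit hb in
lemma partialDeriv_grandSum (x : ι) : partialDeriv x (grandSum b) =
    fun v => iteratedFDeriv ℝ 1 (grandSum b) v (fun i => Pi.single (![x] i) 1) := by
  ext v
  simp [partialDeriv, iteratedFDeriv_one_apply]

lemma partialDeriv_partialDeriv_grandSum (x y : ι) :
    partialDeriv y (partialDeriv x (grandSum b)) =
      fun v => iteratedFDeriv ℝ 2 (grandSum b) v (fun i => Pi.single (![y, x] i) 1) := by
  ext v
  rw [partialDeriv_grandSum, partialDeriv_iteratedFDeriv _ hb.contDiff_grandSum]
  congr 1
  ext i : 1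
  fin_cases i <;> rfl

lemma partialDeriv_grandSum_zero (x : ι) : partialDeriv x (grandSum b) 0 = 1 := by
  rw [partialDeriv_grandSum]
  simp only []
  rw [hb.iteratedFDeriv_grandSum _ fun σ => by simp [pairWeight]]
  simp [pairWeight]

lemma partialDeriv_two_grandSum_zero (x y : ι) :
    partialDeriv y (partialDeriv x (grandSum b)) 0 = b y x := by
  rw [hb.partialDeriv_partialDeriv_grandSum]
  simp only []
  rw [hb.iteratedFDeriv_grandSum _ (hb.pairWeight_perm_two _)]
  have e0 : Finset.Ioi (0 : Fin 2) = {1} := by decide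
  have e1 : Finset.Ioi (1 : Fin 2) = ∅ := by decide
  simp [pairWeight, e0, e1]

lemma partialDeriv_three_grandSum_zero (x y w : ι) :
    partialDeriv w (partialDeriv y (partialDeriv x (grandSum b))) 0 = b w y * b w x * b y x := by
  rw [hb.partialDeriv_partialDeriv_grandSum, partialDeriv_iteratedFDeriv _ hb.contDiff_grandSum]
  have h : (Fin.cons (Pi.single w 1) fun i => Pi.single (![y, x] i) 1 : Fin 3 → ι → ℝ) =
      fun i => Pi.single (![w, y, x] i) 1 := by
    ext i : 1
    fin_cases i <;> rfl
  rw [h, hb.iteratedFDeriv_grandSum _ (hb.pairWeight_perm_three _)]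
  have e0 : Finset.Ioi (0 : Fin 3) = {1, 2} := by decide
  have e1 : Finset.Ioi (1 : Fin 3) = {2} := by decide
  have e2 : Finset.Ioi (2 : Fin 3) = ∅ := by decide
  have h (f : Fin 3 → ℝ) : ∏ j ∈ ({1, 2} : Finset (Fin 3)), f j = f 1 * f 2 :=
    Finset.prod_pair (by decide)
  simp [pairWeight, Fin.prod_univ_three, e0, e1, e2, h]

end StableWeight

end GrandCanonical


/-! ### Inverting densities and activities; the excess free energy as a Legendre transform. -/

section GrandCanonical

open scoped ContDiff

variable {ι : Type*} [Fintype ι] [DecidableEq ι] {b : ι → ι → ℝ}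

variable (b) in
/-- The logarithm of the ratio of density to activity on the site `x`, as a function of the
activities. -/
def logDensityRatio (x : ι) (z : ι → ℝ) : ℝ :=
  Real.log (partialDeriv x (grandSum b) z) - Real.log (grandSum b z)

variable (b) in
/-- `Z` expresses the activities through the densities, near zero density. -/
structure IsActivity (Z : (ι → ℝ) → ι → ℝ) : Prop where
  contDiffAt : ContDiffAt ℝ ω Z 0
  map_zero : Z 0 = 0
  eq : ∀ᶠ v in 𝓝 0, ∀ x, Z v x * Real.exp (logDensityRatio b x (Z v)) = v x

variable (b) in
/-- The excess free energy as a function of the densities, in terms of the activities `Z`. -/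
def excessOfActivity (Z : (ι → ℝ) → ι → ℝ) (v : ι → ℝ) : ℝ :=
  ∑ x, v x - ∑ x, v x * logDensityRatio b x (Z v) - Real.log (grandSum b (Z v))

namespace StableWeight

variable (hb : StableWeight b)
include hb

lemma contDiffAt_logDensityRatio (x : ι) : ContDiffAt ℝ ω (logDensityRatio b x) 0 := by
  refine ContDiffAt.sub (ContDiffAt.log (hb.contDiff_grandSum.contDiffAt.partialDeriv x) ?_)
    (ContDiffAt.log hb.contDiff_grandSum.contDiffAt ?_)
  · simp [hb.partialDeriv_grandSum_zero]
  · simp [grandSum_zero]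

lemma logDensityRatio_zero (x : ι) : logDensityRatio b x 0 = 0 := by
  simp [logDensityRatio, hb.partialDeriv_grandSum_zero, grandSum_zero]

omit [DecidableEq ι] in
lemma eventually_grandSum_pos : ∀ᶠ z in 𝓝 0, 0 < grandSum b z :=
  continuousAt_const.eventually_lt hb.contDiff_grandSum.continuous.continuousAt
    (by simp [grandSum_zero])

lemma eventually_partialDeriv_grandSum_pos (x : ι) :
    ∀ᶠ z in 𝓝 0, 0 < partialDeriv x (grandSum b) z :=
  continuousAt_const.eventually_lt
    (hb.contDiff_grandSum.contDiffAt.partialDeriv x).continuousAt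
    (by simp [hb.partialDeriv_grandSum_zero])

lemma partialDeriv_logDensityRatio (x y : ι) :
    partialDeriv y (logDensityRatio b x) =ᶠ[𝓝 0] fun z =>
      (partialDeriv x (grandSum b) z)⁻¹ * partialDeriv y (partialDeriv x (grandSum b)) z -
        (grandSum b z)⁻¹ * partialDeriv y (grandSum b) z := by
  filter_upwards [hb.eventually_grandSum_pos, hb.eventually_partialDeriv_grandSum_pos x]
    with z h1 h2
  have d1 := (hb.contDiff_grandSum.contDiffAt (x := z)).differentiableAt_omega
  have d2 := ((hb.contDiff_grandSum.contDiffAt (x := z)).partialDeriv x).differentiableAt_omega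
  unfold logDensityRatio
  rw [partialDeriv_sub y (d2.log h2.ne') (d1.log h1.ne'), partialDeriv_log y d2 h2.ne',
    partialDeriv_log y d1 h1.ne']

lemma partialDeriv_logDensityRatio_zero (x y : ι) :
    partialDeriv y (logDensityRatio b x) 0 = b y x - 1 := by
  rw [(hb.partialDeriv_logDensityRatio x y).eq_of_nhds]
  simp [hb.partialDeriv_grandSum_zero, grandSum_zero, hb.partialDeriv_two_grandSum_zero]

/-- Each logarithm contributes a second derivative minus a product of first ones, so the value is `b
w y * b w x * b y x - b y x * b w x - (b w y - 1)`, which factors. -/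
lemma partialDeriv_two_logDensityRatio_zero (x y w : ι) :
    partialDeriv w (partialDeriv y (logDensityRatio b x)) 0 =
      (b w y - 1) * (b w x * b y x - 1) := by
  rw [((hb.partialDeriv_logDensityRatio x y).partialDeriv w).eq_of_nhds]
  have c0 := hb.contDiff_grandSum.contDiffAt (x := 0)
  have d0 := c0.differentiableAt_omega
  have dx := (c0.partialDeriv x).differentiableAt_omega
  have dy := (c0.partialDeriv y).differentiableAt_omega
  have dyx := ((c0.partialDeriv x).partialDeriv y).differentiableAt_omega
  have n0 : grandSum b 0 ≠ 0 := by simp [grandSum_zero]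
  have nx : partialDeriv x (grandSum b) 0 ≠ 0 := by simp [hb.partialDeriv_grandSum_zero]
  rw [partialDeriv_sub w ((dx.fun_inv nx).fun_mul dyx) ((d0.fun_inv n0).fun_mul dy),
    partialDeriv_mul w (dx.fun_inv nx) dyx, partialDeriv_mul w (d0.fun_inv n0) dy,
    partialDeriv_inv w dx nx, partialDeriv_inv w d0 n0]
  simp only [hb.partialDeriv_grandSum_zero, grandSum_zero, hb.partialDeriv_two_grandSum_zero,
    hb.partialDeriv_three_grandSum_zero]
  ring

/-- Inverse function theorem: since `logDensityRatio` vanishes at zero, the map from activities to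
densities is the identity to first order. -/
lemma exists_isActivity : ∃ Z, IsActivity b Z := by
  set R : (ι → ℝ) → ι → ℝ := fun z x => z x * Real.exp (logDensityRatio b x z) with hR
  have hRx (x : ι) : ContDiffAt ℝ ω (fun z => R z x) 0 :=
    ContDiffAt.mul (contDiff_apply ℝ ℝ x).contDiffAt (hb.contDiffAt_logDensityRatio x).exp
  have hRc : ContDiffAt ℝ ω R 0 := contDiffAt_pi.2 hRx
  have hR0 : R 0 = 0 := by ext x; simp [hR]
  have hR' : HasFDerivAt R ((ContinuousLinearEquiv.refl ℝ (ι → ℝ) : (ι → ℝ) ≃L[ℝ] (ι → ℝ)) :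
      (ι → ℝ) →L[ℝ] (ι → ℝ)) 0 := by
    rw [hasFDerivAt_pi']
    intro x
    have h1 : HasFDerivAt (fun z : ι → ℝ => z x)
        (ContinuousLinearMap.proj (R := ℝ) (φ := fun _ : ι => ℝ) x) 0 :=
      (ContinuousLinearMap.proj (R := ℝ) (φ := fun _ : ι => ℝ) x).hasFDerivAt
    have h2 := h1.mul (hb.contDiffAt_logDensityRatio x).exp.differentiableAt_omega.hasFDerivAt
    refine h2.congr_fderiv ?_
    ext w
    simp [hb.logDensityRatio_zero]
  have hn : (ω : WithTop ℕ∞) ≠ 0 := by simp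
  refine ⟨hRc.localInverse hR' hn, ?_, ?_, ?_⟩
  · have := hRc.to_localInverse hR' hn
    rwa [hR0] at this
  · have := hRc.localInverse_apply_image hR' hn
    rwa [hR0] at this
  · have := (hRc.hasStrictFDerivAt' hR' hn).eventually_right_inverse
    rw [hR0] at this
    filter_upwards [this] with v hv x
    exact congrFun hv x

variable {Z : (ι → ℝ) → ι → ℝ} (hZ : IsActivity b Z)
include hZ

lemma contDiffAt_ratio_activity (x : ι) : ContDiffAt ℝ ω (fun v => logDensityRatio b x (Z v)) 0 :=
  ContDiffAt.comp (g := logDensityRatio b x) (0 : ι → ℝ)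
    (hZ.map_zero.symm ▸ hb.contDiffAt_logDensityRatio x) hZ.contDiffAt

omit hb in
lemma contDiffAt_activity_apply (x : ι) : ContDiffAt ℝ ω (fun v => Z v x) 0 :=
  contDiffAt_pi.1 hZ.contDiffAt x

lemma contDiffAt_excessOfActivity : ContDiffAt ℝ ω (excessOfActivity b Z) 0 := by
  refine ContDiffAt.sub (ContDiffAt.sub (ContDiffAt.sum fun x _ => ?_)
    (ContDiffAt.sum fun x _ => ?_)) (ContDiffAt.log ?_ ?_)
  · exact (contDiff_apply ℝ ℝ x).contDiffAt
  · exact ContDiffAt.mul (contDiff_apply ℝ ℝ x).contDiffAt (hb.contDiffAt_ratio_activity hZ x)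
  · exact ContDiffAt.comp (0 : ι → ℝ) hb.contDiff_grandSum.contDiffAt hZ.contDiffAt
  · simp [hZ.map_zero, grandSum_zero]

/-- Solving the defining equation as `Z_x = v_x exp (-logDensityRatio)` gives the derivatives of the
local inverse recursively: at zero density the factor `v_x` lowers by one the order of the unknown
derivatives on the right. -/
lemma partialDeriv_activity (x y : ι) :
    partialDeriv y (fun v => Z v x) =ᶠ[𝓝 0] fun v =>
      Real.exp (-logDensityRatio b x (Z v)) * ((if x = y then 1 else 0) -
        v x * partialDeriv y (fun v => logDensityRatio b x (Z v)) v) := by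
  have h1 : (fun v => Z v x) =ᶠ[𝓝 0] fun v => v x * Real.exp (-logDensityRatio b x (Z v)) := by
    filter_upwards [hZ.eq] with v hv
    rw [← hv x, mul_assoc, ← Real.exp_add]
    simp
  refine (h1.partialDeriv y).trans ?_
  filter_upwards [(hb.contDiffAt_ratio_activity hZ x).eventually_omega] with v hc
  have hd := hc.differentiableAt_omega
  rw [partialDeriv_mul y (differentiableAt_apply x v) hd.fun_neg.exp, partialDeriv_coord,
    partialDeriv_exp y hd.fun_neg, partialDeriv_neg]
  ring

lemma partialDeriv_activity_zero (x y : ι) :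
    partialDeriv y (fun v => Z v x) 0 = if x = y then 1 else 0 := by
  rw [(hb.partialDeriv_activity hZ x y).eq_of_nhds]
  simp [hZ.map_zero, hb.logDensityRatio_zero]

lemma partialDeriv_ratio_activity (x y : ι) :
    partialDeriv y (fun v => logDensityRatio b x (Z v)) =ᶠ[𝓝 0] fun v =>
      ∑ w, partialDeriv w (logDensityRatio b x) (Z v) * partialDeriv y (fun v => Z v w) v := by
  have hc : ∀ᶠ v in 𝓝 0, ContDiffAt ℝ ω (logDensityRatio b x) (Z v) := by
    have := hZ.contDiffAt.continuousAt.tendsto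
    rw [hZ.map_zero] at this
    exact this.eventually (hb.contDiffAt_logDensityRatio x).eventually_omega
  filter_upwards [hc, hZ.contDiffAt.eventually_omega] with v h1 h2
  exact partialDeriv_comp y h1.differentiableAt_omega h2.differentiableAt_omega

lemma partialDeriv_ratio_activity_zero (x y : ι) :
    partialDeriv y (fun v => logDensityRatio b x (Z v)) 0 = b y x - 1 := by
  rw [(hb.partialDeriv_ratio_activity hZ x y).eq_of_nhds]
  simp [hb.partialDeriv_activity_zero hZ, hZ.map_zero, hb.partialDeriv_logDensityRatio_zero]

lemma partialDeriv_two_activity_zero (x y w : ι) :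
    partialDeriv w (partialDeriv y (fun v => Z v x)) 0 =
      -(if x = y then b w x - 1 else 0) - (if x = w then b y x - 1 else 0) := by
  rw [((hb.partialDeriv_activity hZ x y).partialDeriv w).eq_of_nhds]
  have hc := hb.contDiffAt_ratio_activity hZ x
  have hd := hc.differentiableAt_omega
  have hd' := (hc.partialDeriv y).differentiableAt_omega
  have hx := differentiableAt_apply (𝕜 := ℝ) x (0 : ι → ℝ)
  rw [partialDeriv_mul w hd.fun_neg.exp ((differentiableAt_const _).fun_sub (hx.fun_mul hd')),
    partialDeriv_sub w (differentiableAt_const _) (hx.fun_mul hd'), partialDeriv_mul w hx hd',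
    partialDeriv_exp w hd.fun_neg, partialDeriv_neg, partialDeriv_coord, partialDeriv_const]
  simp only [hZ.map_zero, hb.logDensityRatio_zero, hb.partialDeriv_ratio_activity_zero hZ]
  split_ifs <;> simp
  ring

/-- With `f = b - 1`, the activity expansion gives `f_wy (f_wx f_yx + f_wx + f_yx)`. The second
derivatives of `Z` in the chain rule subtract `f_wy f_wx + f_wy f_yx`, and the triangle is left. -/
lemma partialDeriv_two_ratio_activity_zero (x y w : ι) :
    partialDeriv w (partialDeriv y (fun v => logDensityRatio b x (Z v))) 0 =
      (b x y - 1) * (b y w - 1) * (b w x - 1) := by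
  rw [((hb.partialDeriv_ratio_activity hZ x y).partialDeriv w).eq_of_nhds]
  have hc (k : ι) := hZ.map_zero.symm ▸ (hb.contDiffAt_logDensityRatio x).partialDeriv k
  have hdk (k : ι) : DifferentiableAt ℝ (fun v => partialDeriv k (logDensityRatio b x) (Z v)) 0 :=
    (ContDiffAt.comp (0 : ι → ℝ) (hc k) hZ.contDiffAt).differentiableAt_omega
  have hdZ (k : ι) := ((contDiffAt_activity_apply hZ k).partialDeriv y).differentiableAt_omega
  rw [partialDeriv_sum w _ fun k _ => (hdk k).fun_mul (hdZ k)]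
  simp only [partialDeriv_mul w (hdk _) (hdZ _), hb.partialDeriv_two_activity_zero hZ,
    partialDeriv_comp w (hc _).differentiableAt_omega hZ.contDiffAt.differentiableAt_omega,
    hb.partialDeriv_activity_zero hZ, hZ.map_zero, hb.partialDeriv_two_logDensityRatio_zero,
    hb.partialDeriv_logDensityRatio_zero]
  simp [Finset.sum_add_distrib, mul_sub, Finset.sum_sub_distrib]
  rw [hb.symm y x, hb.symm w y]
  ring

/-- The envelope property of the Legendre transform: the dependence through `Z` drops out, because
the change of `log Ξ` balances that of `∑ v_x logDensityRatio`. -/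
lemma partialDeriv_excessOfActivity (y : ι) :
    partialDeriv y (excessOfActivity b Z) =ᶠ[𝓝 0] fun v => -logDensityRatio b y (Z v) := by
  have hZt := hZ.contDiffAt.continuousAt.tendsto
  rw [hZ.map_zero] at hZt
  have hc : ∀ᶠ v in 𝓝 0, ∀ x, ContDiffAt ℝ ω (fun v => logDensityRatio b x (Z v)) v :=
    eventually_all.2 fun x => (hb.contDiffAt_ratio_activity hZ x).eventually_omega
  have hpd : ∀ᶠ v in 𝓝 0, ∀ x, 0 < partialDeriv x (grandSum b) (Z v) :=
    eventually_all.2 fun x => hZt.eventually (hb.eventually_partialDeriv_grandSum_pos x)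
  have hact := eventually_all.2 fun x => (hb.partialDeriv_activity hZ x y).eventually
  filter_upwards [hc, hpd, hact, hZt.eventually hb.eventually_grandSum_pos,
    hZ.contDiffAt.eventually_omega] with v h1 h2 h3 h4 h5
  have hx (x : ι) := differentiableAt_apply (𝕜 := ℝ) x v
  have hd (x : ι) := (h1 x).differentiableAt_omega
  have hP := (hb.contDiff_grandSum.contDiffAt (x := Z v)).differentiableAt_omega
  have hdZ := h5.differentiableAt_omega
  have hPZ : DifferentiableAt ℝ (fun v => grandSum b (Z v)) v := hP.comp v hdZ
  unfold excessOfActivity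
  rw [partialDeriv_sub y ((DifferentiableAt.fun_sum fun x _ => hx x).fun_sub
      (DifferentiableAt.fun_sum fun x _ => (hx x).fun_mul (hd x))) (hPZ.log h4.ne'),
    partialDeriv_sub y (DifferentiableAt.fun_sum fun x _ => hx x)
      (DifferentiableAt.fun_sum fun x _ => (hx x).fun_mul (hd x)),
    partialDeriv_sum y _ fun x _ => hx x, partialDeriv_sum y _ fun x _ => (hx x).fun_mul (hd x),
    partialDeriv_log y hPZ h4.ne', partialDeriv_comp y hP hdZ, Finset.mul_sum]
  -- Here `exp (-logDensityRatio) = Ξ / ∂_xΞ` cancels the logarithmic derivative of `Ξ` exactly.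
  have hterm (x : ι) : (grandSum b (Z v))⁻¹ * (partialDeriv x (grandSum b) (Z v) *
      partialDeriv y (fun v => Z v x) v) = (if x = y then 1 else 0) -
        v x * partialDeriv y (fun v => logDensityRatio b x (Z v)) v := by
    rw [h3 x, Real.exp_neg, logDensityRatio, Real.exp_sub, Real.exp_log (h2 x), Real.exp_log h4]
    have := (h2 x).ne'
    have := h4.ne'
    field_simp
  simp only [hterm, partialDeriv_mul y (hx _) (hd _), partialDeriv_coord, Finset.sum_add_distrib,
    Finset.sum_sub_distrib]
  simp

end StableWeight

/-- The Legendre transform of the logarithm of the partition function is attained at the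
activities that produce the given densities. -/
lemma StableWeight.legendre_le (hb : StableWeight b) {u v : ι → ℝ}
    (hv : ∀ x, Real.exp (u x) * partialDeriv x (grandSum b) (fun x => Real.exp (u x)) =
      v x * grandSum b fun x => Real.exp (u x)) (u' : ι → ℝ) :
    ∑ x, v x * u' x - Real.log (grandSum b fun x => Real.exp (u' x)) ≤
      ∑ x, v x * u x - Real.log (grandSum b fun x => Real.exp (u x)) := by
  set z : ι → ℝ := fun x => Real.exp (u x) with hz
  have hz0 : ∀ x, 0 ≤ z x := fun x => (Real.exp_pos _).le
  set h : ι → ℝ := fun x => u' x - u x with hh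
  set m : ℝ := ∑ x, v x * h x with hm
  have hconv := hb.convexOn_tilt hz0 h m
  have hline : HasDerivAt (fun t : ℝ => fun x => z x * Real.exp (t * h x))
      (fun x => z x * h x) 0 := by
    rw [hasDerivAt_pi]
    intro x
    simpa using (((hasDerivAt_id (0 : ℝ)).mul_const (h x)).exp).const_mul (z x)
  have hP : HasFDerivAt (grandSum b) (fderiv ℝ (grandSum b) z)
      (fun x => z x * Real.exp ((0 : ℝ) * h x)) := by
    simpa using (hb.contDiff_grandSum.contDiffAt (x := z)).differentiableAt_omega.hasFDerivAt
  have hexp : HasDerivAt (fun t : ℝ => Real.exp (-(t * m))) (-m) 0 := by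
    simpa using ((hasDerivAt_id (0 : ℝ)).mul_const m).neg.exp
  have hder := hexp.mul (hP.comp_hasDerivAt (0 : ℝ) hline)
  -- By `hv`, the logarithmic derivative of `Ξ` in the direction `h` is `∑ v_x h_x = m`; the factor
  -- `e^{-tm}` makes the tilt stationary at `t = 0`.
  have h0 : -m * (grandSum b ∘ fun t x => z x * Real.exp (t * h x)) 0 +
      Real.exp (-(0 * m)) * (fderiv ℝ (grandSum b) z) (fun x => z x * h x) = 0 := by
    rw [fderiv_apply_eq_sum_partialDeriv]
    have : ∀ x, z x * h x * partialDeriv x (grandSum b) z = v x * h x * grandSum b z := by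
      intro x
      rw [mul_right_comm, hv x]
      ring
    simp only [this, ← Finset.sum_mul, Function.comp_apply]
    simp [hm]
  rw [h0] at hder
  -- A convex function that is stationary at `0` is no smaller at `1`, where the tilt has turned `u`
  -- into `u'`. Taking logarithms gives the claim.
  have hs := hconv.le_slope_of_hasDerivAt (mem_univ 0) (mem_univ 1) one_pos hder
  rw [slope_def_field] at hs
  have e1 : (fun x => z x * Real.exp (1 * h x)) = fun x => Real.exp (u' x) := by
    ext x
    simp only [hz, hh, ← Real.exp_add]
    congr 1
    ring
  simp only [e1] at hs
  simp only [one_mul, sub_zero, div_one, zero_mul, neg_zero, Real.exp_zero, mul_one,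
    sub_nonneg] at hs
  have p1 : 0 < grandSum b z := one_pos.trans_le (hb.one_le_grandSum hz0)
  have p2 : 0 < grandSum b fun x => Real.exp (u' x) :=
    one_pos.trans_le (hb.one_le_grandSum fun x => (Real.exp_pos _).le)
  have := Real.log_le_log p1 hs
  rw [Real.log_mul (Real.exp_pos _).ne' p2.ne', Real.log_exp] at this
  have e2 : m = ∑ x, v x * u' x - ∑ x, v x * u x := by
    rw [hm, ← Finset.sum_sub_distrib]
    exact Finset.sum_congr rfl fun x _ => by simp [hh]; ring
  linarith

/-- Near zero density the Legendre transform, minus its ideal part, is `excessOfActivity`. -/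
lemma StableWeight.eventually_legendre_eq (hb : StableWeight b) {Z : (ι → ℝ) → ι → ℝ}
    (hZ : IsActivity b Z) : ∀ᶠ v in 𝓝 0, (∀ x, 0 < v x) →
      (⨆ u : ι → ℝ, (∑ x, v x * u x - Real.log (grandSum b fun x => Real.exp (u x)))) -
        ∑ x, v x * (Real.log (v x) - 1) = excessOfActivity b Z v := by
  have hZt := hZ.contDiffAt.continuousAt.tendsto
  rw [hZ.map_zero] at hZt
  have hpd : ∀ᶠ v in 𝓝 0, ∀ x, 0 < partialDeriv x (grandSum b) (Z v) :=
    eventually_all.2 fun x => hZt.eventually (hb.eventually_partialDeriv_grandSum_pos x)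
  filter_upwards [hpd, hZt.eventually hb.eventually_grandSum_pos, hZ.eq] with v h1 h2 h3 hv
  -- Positive densities force positive activities, so `u = log Z` is an admissible potential.
  have hpos : ∀ x, 0 < Z v x := fun x =>
    pos_of_mul_pos_left ((h3 x).symm ▸ hv x) (Real.exp_pos _).le
  have hu : (fun x => Real.exp (Real.log (Z v x))) = Z v := by
    ext x
    rw [Real.exp_log (hpos x)]
  have hle := hb.legendre_le (u := fun x => Real.log (Z v x)) (v := v) fun x => by
    rw [hu, Real.exp_log (hpos x), ← h3 x, logDensityRatio, Real.exp_sub, Real.exp_log (h1 x),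
      Real.exp_log h2]
    have := h2.ne'
    field_simp
  rw [hu] at hle
  have hsup : (⨆ u : ι → ℝ, (∑ x, v x * u x - Real.log (grandSum b fun x => Real.exp (u x)))) =
      ∑ x, v x * Real.log (Z v x) - Real.log (grandSum b (Z v)) := by
    refine le_antisymm (ciSup_le hle) ?_
    refine le_trans ?_ (le_ciSup ⟨_, forall_mem_range.2 hle⟩ fun x => Real.log (Z v x))
    simp only [hu, le_refl]
  rw [hsup, excessOfActivity]
  have : ∀ x, v x * (Real.log (v x) - 1) =
      v x * Real.log (Z v x) + v x * logDensityRatio b x (Z v) - v x := by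
    intro x
    have : Real.log (v x) = Real.log (Z v x) + logDensityRatio b x (Z v) := by
      conv_lhs => rw [← h3 x, Real.log_mul (hpos x).ne' (Real.exp_pos _).ne', Real.log_exp]
    rw [this]
    ring
  simp only [this, Finset.sum_sub_distrib, Finset.sum_add_distrib]
  ring

end GrandCanonical


/-! ### Low-density limits and Taylor data of functionals. -/

section LowDensity

open scoped ContDiff

variable {X : Type*} {Λ : Finset X}

lemma profile_apply (v : Λ → ℝ) (x : Λ) : profile Λ v x = v x := by
  simp [profile, Finsupp.indicator_of_mem]

lemma profile_apply_of_notMem (v : Λ → ℝ) {x : X} (hx : x ∉ Λ) : profile Λ v x = 0 := by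
  simp [profile, Finsupp.indicator_of_notMem hx]

lemma update_profile [DecidableEq X] (v : Λ → ℝ) (x : Λ) (t : ℝ) :
    (profile Λ v).update x t = profile Λ (Function.update v x t) := by
  ext y
  by_cases hy : y ∈ Λ
  · rw [profile_apply _ ⟨y, hy⟩]
    by_cases h : y = x
    · subst h
      simp
    · rw [Function.update_of_ne (fun h' => h (congrArg Subtype.val h'))]
      simp [h, profile_apply v ⟨y, hy⟩]
  · rw [profile_apply_of_notMem _ hy]
    have h : y ≠ x := fun h => hy (h ▸ x.2)
    simp [h, profile_apply_of_notMem _ hy]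

lemma isOpen_positive : IsOpen {v : Λ → ℝ | ∀ x, 0 < v x} := by
  simp only [ofPred_forall]
  exact isOpen_iInter_of_finite fun x => isOpen_lt continuous_const (continuous_apply x)

instance lowDensity_neBot : (lowDensity Λ).NeBot := by
  have hc : Tendsto (fun (t : ℝ) (_ : Λ) => t) (𝓝[>] 0) (lowDensity Λ) := by
    refine tendsto_nhdsWithin_iff.2 ⟨?_, ?_⟩
    · exact tendsto_pi_nhds.2 fun _ => tendsto_nhdsWithin_of_tendsto_nhds tendsto_id
    · filter_upwards [self_mem_nhdsWithin] with t ht x using ht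
  exact hc.neBot

/-- Positive profiles form an open set, so an identity valid only there still holds on full
neighbourhoods of its points and can be differentiated. -/
lemma eventually_lowDensity_nhds {p : (Λ → ℝ) → Prop} (h : ∀ᶠ v in lowDensity Λ, p v) :
    ∀ᶠ v in lowDensity Λ, ∀ᶠ w in 𝓝 v, p w := by
  rw [lowDensity, eventually_nhdsWithin_iff] at h ⊢
  filter_upwards [eventually_eventually_nhds.2 h] with v hv hpos
  filter_upwards [hv, isOpen_positive.mem_nhds hpos] with w hw hw' using hw hw'

variable {G : (X →₀ ℝ) → ℝ} {H : (Λ → ℝ) → ℝ}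

/-- The conclusion has the form of the hypothesis `h`, with the derivatives in place of `G` and `H`,
so the lemma can be iterated to reach second and third derivatives. -/
lemma eventually_functionalDeriv [DecidableEq X] (hH : ContDiffAt ℝ ω H 0)
    (h : ∀ᶠ v in lowDensity Λ, G (profile Λ v) = H v) (x : Λ) :
    ∀ᶠ v in lowDensity Λ, functionalDeriv (x : X) G (profile Λ v) = partialDeriv x H v := by
  filter_upwards [eventually_lowDensity_nhds h,
    hH.eventually_omega.filter_mono nhdsWithin_le_nhds] with v hv hd
  rw [← deriv_update_eq_partialDeriv x hd.differentiableAt_omega, functionalDeriv, profile_apply]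
  refine Filter.EventuallyEq.deriv_eq ?_
  have hc : Tendsto (Function.update v x) (𝓝 (v x)) (𝓝 v) := by
    have := (hasDerivAt_update v x (v x)).continuousAt.tendsto
    rwa [Function.update_eq_self] at this
  filter_upwards [hc.eventually hv] with t ht
  rw [← ht, ← update_profile]

open scoped Classical

/-- The functional `G` is analytic at zero density on `Λ`, with the second and third derivatives
`-A` and `-T` there. -/
def HasLowDensityJet (G : (X →₀ ℝ) → ℝ) (Λ : Finset X) (A : X → X → ℝ) (T : X → X → X → ℝ) :
    Prop :=
  ∃ H : (Λ → ℝ) → ℝ, ContDiffAt ℝ ω H 0 ∧ (∀ᶠ v in lowDensity Λ, G (profile Λ v) = H v) ∧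
    (∀ x y : Λ, partialDeriv x (partialDeriv y H) 0 = -A x y) ∧
    ∀ x y z : Λ, partialDeriv x (partialDeriv y (partialDeriv z H)) 0 = -T x y z

namespace HasLowDensityJet

variable {A A' : X → X → ℝ} {T T' : X → X → X → ℝ} {G' : (X →₀ ℝ) → ℝ}

lemma smoothAtLowDensity (h : HasLowDensityJet G Λ A T) : SmoothAtLowDensity G Λ := by
  obtain ⟨H, hH, hG, -, -⟩ := h
  filter_upwards [eventually_lowDensity_nhds hG,
    hH.eventually_omega.filter_mono nhdsWithin_le_nhds] with v hv hd
  exact (hd.of_le (by exact le_top)).congr_of_eventuallyEq hv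

lemma tendsto_pairDCF (h : HasLowDensityJet G Λ A T) (x y : Λ) :
    Tendsto (fun v => pairDCF G x y (profile Λ v)) (lowDensity Λ) (𝓝 (A x y)) := by
  obtain ⟨H, hH, hG, h2, -⟩ := h
  have e := eventually_functionalDeriv (hH.partialDeriv y) (eventually_functionalDeriv hH hG y) x
  have ht := ((hH.partialDeriv y).partialDeriv x).continuousAt.tendsto.neg
  rw [h2, neg_neg] at ht
  refine (ht.mono_left nhdsWithin_le_nhds).congr' ?_
  filter_upwards [e] with v hv
  rw [pairDCF, hv]

lemma tendsto_tripletDCF (h : HasLowDensityJet G Λ A T) (x y z : Λ) :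
    Tendsto (fun v => tripletDCF G x y z (profile Λ v)) (lowDensity Λ) (𝓝 (T x y z)) := by
  obtain ⟨H, hH, hG, -, h3⟩ := h
  have e := eventually_functionalDeriv ((hH.partialDeriv z).partialDeriv y)
    (eventually_functionalDeriv (hH.partialDeriv z) (eventually_functionalDeriv hH hG z) y) x
  have ht := (((hH.partialDeriv z).partialDeriv y).partialDeriv x).continuousAt.tendsto.neg
  rw [h3, neg_neg] at ht
  refine (ht.mono_left nhdsWithin_le_nhds).congr' ?_
  filter_upwards [e] with v hv
  rw [tripletDCF, hv]

lemma pairDCF_isLittleO (h : HasLowDensityJet G Λ A T) (x y : Λ) :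
    (fun v => pairDCF G x y (profile Λ v) - (A x y + ∑ z : Λ, v z * T z x y))
      =o[lowDensity Λ] fun v => ‖v‖ := by
  obtain ⟨H, hH, hG, h2, h3⟩ := h
  have e := eventually_functionalDeriv (hH.partialDeriv y) (eventually_functionalDeriv hH hG y) x
  have hd := ((hH.partialDeriv y).partialDeriv x).differentiableAt_omega.hasFDerivAt.isLittleO
  refine (hd.neg_left.norm_right.mono nhdsWithin_le_nhds).congr' ?_ (by simp)
  filter_upwards [e] with v hv
  rw [pairDCF, hv, fderiv_apply_eq_sum_partialDeriv, h2]
  simp only [h3, sub_zero, mul_neg, Finset.sum_neg_distrib]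
  ring

lemma sub_pairDCF_isLittleO (h : HasLowDensityJet G Λ A T) (h' : HasLowDensityJet G' Λ A' T')
    (x y : Λ) (hA : A x y = A' x y) (hT : ∀ z : Λ, T z x y = T' z x y) :
    (fun v => pairDCF G x y (profile Λ v) - pairDCF G' x y (profile Λ v))
      =o[lowDensity Λ] fun v => ‖v‖ := by
  refine ((h.pairDCF_isLittleO x y).sub (h'.pairDCF_isLittleO x y)).congr_left fun v => ?_
  simp only [hA, hT]
  ring

lemma congr (h : HasLowDensityJet G Λ A T)
    (hG : ∀ᶠ v in lowDensity Λ, G' (profile Λ v) = G (profile Λ v))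
    (hA : ∀ x ∈ Λ, ∀ y ∈ Λ, A' x y = A x y)
    (hT : ∀ x ∈ Λ, ∀ y ∈ Λ, ∀ z ∈ Λ, T' x y z = T x y z) : HasLowDensityJet G' Λ A' T' := by
  obtain ⟨H, hH, hGH, h2, h3⟩ := h
  refine ⟨H, hH, ?_, fun x y => ?_, fun x y z => ?_⟩
  · filter_upwards [hG, hGH] with v h1 h2 using h1.trans h2
  · rw [h2, hA x x.2 y y.2]
  · rw [h3, hT x x.2 y y.2 z z.2]

lemma sum {κ : Type*} (s : Finset κ) (c : κ → ℝ) {G : κ → (X →₀ ℝ) → ℝ} {A : κ → X → X → ℝ}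
    {T : κ → X → X → X → ℝ} (h : ∀ i ∈ s, HasLowDensityJet (G i) Λ (A i) (T i)) :
    HasLowDensityJet (fun ρ => ∑ i ∈ s, c i * G i ρ) Λ (fun x y => ∑ i ∈ s, c i * A i x y)
      (fun x y z => ∑ i ∈ s, c i * T i x y z) := by
  choose! H hH hG h2 h3 using h
  have step (F : κ → (Λ → ℝ) → ℝ) (hF : ∀ i ∈ s, ContDiffAt ℝ ω (F i) 0) (y : Λ) :
      partialDeriv y (fun v => ∑ i ∈ s, c i * F i v) =ᶠ[𝓝 0]
        fun v => ∑ i ∈ s, c i * partialDeriv y (F i) v := by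
    filter_upwards [(Finset.eventually_all s).2 fun i hi => (hF i hi).eventually_omega] with v hv
    rw [partialDeriv_sum y s fun i hi => (hv i hi).differentiableAt_omega.const_mul (c i)]
    refine Finset.sum_congr rfl fun i hi => ?_
    rw [partialDeriv_mul y (differentiableAt_const _) (hv i hi).differentiableAt_omega,
      partialDeriv_const, zero_mul, zero_add]
  have step2 (y z : Λ) := (((step H hH z).partialDeriv y).trans
    (step _ (fun i hi => (hH i hi).partialDeriv z) y))
  refine ⟨fun v => ∑ i ∈ s, c i * H i v, ?_, ?_, fun x y => ?_, fun x y z => ?_⟩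
  · exact ContDiffAt.sum fun i hi => contDiffAt_const.mul (hH i hi)
  · filter_upwards [(Finset.eventually_all s).2 hG] with v hv
    exact Finset.sum_congr rfl fun i hi => by rw [hv i hi]
  · rw [(step2 x y).eq_of_nhds, ← Finset.sum_neg_distrib]
    exact Finset.sum_congr rfl fun i hi => by rw [h2 i hi]; ring
  · rw [((step2 y z).partialDeriv x).eq_of_nhds, (step _ (fun i hi =>
      ((hH i hi).partialDeriv z).partialDeriv y) x).eq_of_nhds, ← Finset.sum_neg_distrib]
    exact Finset.sum_congr rfl fun i hi => by rw [h3 i hi]; ring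

end HasLowDensityJet

end LowDensity

/-! ### Functions that depend on a subset of the coordinates. -/

section Restriction

open scoped ContDiff

variable {ι κ : Type*} [Fintype ι] [DecidableEq ι] [Fintype κ] [DecidableEq κ]
  {e : κ → ι} {g : (κ → ℝ) → ℝ} {a : κ → ℝ}

omit [DecidableEq ι] [DecidableEq κ] in
lemma contDiffAt_comp_index (hg : ContDiffAt ℝ ω g 0) :
    ContDiffAt ℝ ω (fun v : ι → ℝ => g fun k => v (e k)) 0 :=
  ContDiffAt.comp (g := g) (0 : ι → ℝ) hg
    (contDiff_pi.2 fun k => contDiff_apply ℝ ℝ (e k)).contDiffAt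

lemma partialDeriv_comp_index (hg : ContDiffAt ℝ ω g 0) (y : ι) :
    partialDeriv y (fun v : ι → ℝ => g fun k => v (e k)) =ᶠ[𝓝 0] fun v =>
      ∑ k, (if e k = y then 1 else 0) * partialDeriv k g fun k => v (e k) := by
  have hc : Continuous fun (v : ι → ℝ) k => v (e k) := by fun_prop
  filter_upwards [hc.tendsto' 0 0 rfl |>.eventually hg.eventually_omega] with v hv
  rw [partialDeriv_comp y hv.differentiableAt_omega (by fun_prop)]
  exact Finset.sum_congr rfl fun k _ => by rw [partialDeriv_coord, mul_comm]

lemma partialDeriv_comp_index_of_mem (he : Function.Injective e) (hg : ContDiffAt ℝ ω g 0)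
    (k : κ) : partialDeriv (e k) (fun v : ι → ℝ => g fun k => v (e k)) =ᶠ[𝓝 0] fun v =>
      partialDeriv k g fun k => v (e k) := by
  filter_upwards [partialDeriv_comp_index hg (e k)] with v hv
  rw [hv, Finset.sum_eq_single k (fun j _ hj => by rw [if_neg (he.ne hj), zero_mul]) (by simp),
    if_pos rfl, one_mul]

lemma partialDeriv_comp_index_of_notMem (hg : ContDiffAt ℝ ω g 0) {y : ι} (hy : y ∉ range e) :
    partialDeriv y (fun v : ι → ℝ => g fun k => v (e k)) =ᶠ[𝓝 0] fun _ => 0 := by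
  filter_upwards [partialDeriv_comp_index hg y] with v hv
  rw [hv]
  exact Finset.sum_eq_zero fun k _ => by rw [if_neg fun h => hy ⟨k, h⟩, zero_mul]

end Restriction


/-! ### Boltzmann factors of energies that may be infinite. -/

section Boltzmann

lemma boltzmann_coe (r : ℝ) : boltzmann r = Real.exp (-r) := rfl

lemma boltzmann_top : boltzmann ⊤ = 0 := rfl

lemma boltzmann_nonneg (e : WithTop ℝ) : 0 ≤ boltzmann e := by
  induction e with
  | top => exact le_rfl
  | coe r => exact (Real.exp_pos _).le

lemma boltzmann_add (e e' : WithTop ℝ) : boltzmann (e + e') = boltzmann e * boltzmann e' := by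
  induction e with
  | top => simp [boltzmann_top]
  | coe r =>
    induction e' with
    | top => simp [boltzmann_top]
    | coe s => rw [← WithTop.coe_add, boltzmann_coe, neg_add, Real.exp_add]; rfl

lemma boltzmann_sum {κ : Type*} (s : Finset κ) (e : κ → WithTop ℝ) :
    boltzmann (∑ i ∈ s, e i) = ∏ i ∈ s, boltzmann (e i) := by
  classical
  induction s using Finset.induction_on with
  | empty => simpa using boltzmann_coe 0
  | insert i s hi ih => rw [Finset.sum_insert hi, Finset.prod_insert hi, boltzmann_add, ih]

lemma boltzmann_le {r : ℝ} {e : WithTop ℝ} (h : (r : WithTop ℝ) ≤ e) :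
    boltzmann e ≤ Real.exp (-r) := by
  induction e with
  | top => exact (Real.exp_pos _).le
  | coe s => exact Real.exp_le_exp.2 (neg_le_neg (WithTop.coe_le_coe.1 h))

end Boltzmann

/-! ### The low-density expansion of the exact functional of a cluster. -/

namespace PairPotential

open scoped ContDiff

variable {X : Type*} (V : PairPotential X)

lemma mayer_symm (x y : X) : V.mayer x y = V.mayer y x := by
  rw [mayer, mayer, V.symm]

/-- The Boltzmann factors of the pairs of sites of `S`. -/
def weight (S : Finset X) (x y : S) : ℝ := boltzmann (V.energy x y)

lemma stableWeight (S : Finset X) : StableWeight (V.weight S) where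
  nonneg _ _ := boltzmann_nonneg _
  symm x y := by rw [weight, V.symm]; rfl
  stable := by
    obtain ⟨B, hB⟩ := V.stable S
    refine ⟨B, fun N x => ?_⟩
    have := boltzmann_le (hB N (fun i => x i) fun i => (x i).2)
    rw [neg_neg, boltzmann_sum] at this
    simp only [boltzmann_sum] at this
    exact this

lemma partitionFunction_eq (S : Finset X) (u : X → ℝ) :
    V.partitionFunction S u = grandSum (V.weight S) fun x => Real.exp (u x) := by
  rw [grandSum_eq, partitionFunction]
  refine tsum_congr fun N => ?_
  congr 1
  refine Finset.sum_congr rfl fun x _ => ?_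
  rw [Real.exp_sum, mul_comm]
  rfl

lemma finiteFreeEnergy_eq (S : Finset X) (ρ : X → ℝ) :
    V.finiteFreeEnergy S ρ = ⨆ u : S → ℝ, (∑ x : S, ρ x * u x -
      Real.log (grandSum (V.weight S) fun x => Real.exp (u x))) := by
  -- Every potential on `S` extends to `X`, and only its values on `S` matter, so the two suprema
  -- agree.
  have hsurj : Function.Surjective fun (u : X → ℝ) (x : S) => u x :=
    fun u => ⟨Function.extend Subtype.val u 0, funext fun x =>
      Subtype.val_injective.extend_apply u 0 x⟩
  rw [← hsurj.iSup_comp]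
  refine iSup_congr fun u => ?_
  rw [partitionFunction_eq, ← Finset.sum_coe_sort S fun x => ρ x * u x]

lemma occupiedSites_profile [DecidableEq X] {Λ : Finset X} {C : Set X} [DecidablePred (· ∈ C)]
    {v : Λ → ℝ} (hv : ∀ x, 0 < v x) :
    occupiedSites C (profile Λ v) = {x ∈ Λ | x ∈ C} := by
  ext x
  simp only [occupiedSites, Finset.mem_filter, Finsupp.mem_support_iff]
  by_cases hx : x ∈ Λ
  · simp [hx, profile_apply v ⟨x, hx⟩, (hv _).ne']
  · simp [hx, profile_apply_of_notMem v hx]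

/-- With no occupied site, `Ξ = 1` and both parts vanish. This is what lets clusters missing the
support drop out of the Möbius sum. -/
lemma excessFreeEnergy_eq_zero {C : Set X} {ρ : X →₀ ℝ} (h : occupiedSites C ρ = ∅) :
    V.excessFreeEnergy C ρ = 0 := by
  have (u : (∅ : Finset X) → ℝ) : grandSum (V.weight ∅) u = 1 := by
    rw [Subsingleton.elim u 0, StableWeight.grandSum_zero]
  simp [excessFreeEnergy, freeEnergy, idealFreeEnergy, h, finiteFreeEnergy_eq, this]

open Classical in
/-- The low-density expansion of the exact excess functional of a cluster. -/
lemma hasLowDensityJet_excessFreeEnergy (C : Set X) (Λ : Finset X) :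
    HasLowDensityJet (V.excessFreeEnergy C) Λ
      (fun x y => if {x, y} ⊆ C then V.mayer x y else 0)
      (fun x y z => if {x, y, z} ⊆ C then V.mayerTriangle x y z else 0) := by
  -- On profiles positive exactly on `Λ`, the functional of `C` is that of the finite system on `S =
  -- Λ ∩ C`, composed with restriction of the densities along `e : S → Λ`. Derivatives at sites
  -- outside `C` vanish.
  set S : Finset X := {x ∈ Λ | x ∈ C}
  have hb := V.stableWeight S
  obtain ⟨Z, hZ⟩ := hb.exists_isActivity
  let e : S → Λ := fun x => ⟨x, (Finset.mem_filter.1 x.2).1⟩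
  have he : Function.Injective e := fun x y h => Subtype.ext (congrArg (fun z : Λ => (z : X)) h)
  have hmem (x : Λ) (hx : (x : X) ∈ C) : ∃ k, e k = x :=
    ⟨⟨x, Finset.mem_filter.2 ⟨x.2, hx⟩⟩, rfl⟩
  have hnot (x : Λ) (hx : (x : X) ∉ C) : x ∉ range e := by
    rintro ⟨k, rfl⟩
    exact hx (Finset.mem_filter.1 k.2).2
  have hzero (x : Λ) : partialDeriv x (fun _ => 0) = fun _ => 0 :=
    funext fun v => partialDeriv_const x 0
  set F := excessOfActivity (V.weight S) Z
  have hFc : ContDiffAt ℝ ω F 0 := hb.contDiffAt_excessOfActivity hZ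
  have h2 (k l : S) : partialDeriv k (partialDeriv l F) 0 = -V.mayer k l := by
    rw [((hb.partialDeriv_excessOfActivity hZ l).partialDeriv k).eq_of_nhds, partialDeriv_neg,
      hb.partialDeriv_ratio_activity_zero hZ]
    rfl
  have h3 (k l m : S) : partialDeriv k (partialDeriv l (partialDeriv m F)) 0 =
      -V.mayerTriangle k l m := by
    have : partialDeriv l (fun v => -logDensityRatio (V.weight S) m (Z v)) = fun v =>
        -partialDeriv l (fun v => logDensityRatio (V.weight S) m (Z v)) v :=
      funext fun v => partialDeriv_neg l
    rw [(((hb.partialDeriv_excessOfActivity hZ m).partialDeriv l).partialDeriv k).eq_of_nhds,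
      this, partialDeriv_neg, hb.partialDeriv_two_ratio_activity_zero hZ, mayerTriangle,
      V.mayer_symm k l, V.mayer_symm l m, V.mayer_symm m k]
    simp only [weight, mayer]
    ring
  refine ⟨fun v => F fun k => v (e k), contDiffAt_comp_index hFc, ?_, fun x y => ?_,
    fun x y z => ?_⟩
  · have hc : Continuous fun (v : Λ → ℝ) k => v (e k) := by fun_prop
    have hev := hc.tendsto' 0 0 rfl |>.eventually (hb.eventually_legendre_eq hZ)
    rw [lowDensity, eventually_nhdsWithin_iff]
    filter_upwards [hev] with v hv hpos
    have hρ (k : S) : profile Λ v k = v (e k) := profile_apply v (e k)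
    refine Eq.trans ?_ (hv fun k => hpos _)
    rw [excessFreeEnergy, freeEnergy, idealFreeEnergy,
      occupiedSites_profile hpos, finiteFreeEnergy_eq,
      ← Finset.sum_coe_sort S fun x => profile Λ v x * (Real.log (profile Λ v x) - 1)]
    simp only [hρ]
    rfl
  · beta_reduce
    by_cases hy : (y : X) ∈ C
    · obtain ⟨l, rfl⟩ := hmem y hy
      rw [((partialDeriv_comp_index_of_mem he hFc l).partialDeriv x).eq_of_nhds]
      by_cases hx : (x : X) ∈ C
      · obtain ⟨k, rfl⟩ := hmem x hx
        rw [(partialDeriv_comp_index_of_mem he (hFc.partialDeriv l) k).eq_of_nhds,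
          if_pos (by simp [insert_subset_iff, hx, hy])]
        exact h2 k l
      · rw [(partialDeriv_comp_index_of_notMem (hFc.partialDeriv l) (hnot x hx)).eq_of_nhds,
          if_neg (by simp [insert_subset_iff, hx]), neg_zero]
    · rw [((partialDeriv_comp_index_of_notMem hFc (hnot y hy)).partialDeriv x).eq_of_nhds, hzero,
        if_neg (by simp [insert_subset_iff, hy]), neg_zero]
  · beta_reduce
    by_cases hz : (z : X) ∈ C
    · obtain ⟨m, rfl⟩ := hmem z hz
      rw [(((partialDeriv_comp_index_of_mem he hFc m).partialDeriv y).partialDeriv x).eq_of_nhds]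
      by_cases hy : (y : X) ∈ C
      · obtain ⟨l, rfl⟩ := hmem y hy
        have hFm := hFc.partialDeriv m
        rw [((partialDeriv_comp_index_of_mem he hFm l).partialDeriv x).eq_of_nhds]
        by_cases hx : (x : X) ∈ C
        · obtain ⟨k, rfl⟩ := hmem x hx
          rw [(partialDeriv_comp_index_of_mem he (hFm.partialDeriv l) k).eq_of_nhds,
            if_pos (by simp [insert_subset_iff, hx, hy, hz])]
          exact h3 k l m
        · rw [(partialDeriv_comp_index_of_notMem (hFm.partialDeriv l) (hnot x hx)).eq_of_nhds,
            if_neg (by simp [insert_subset_iff, hx]), neg_zero]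
      · rw [((partialDeriv_comp_index_of_notMem (hFc.partialDeriv m)
          (hnot y hy)).partialDeriv x).eq_of_nhds, hzero,
          if_neg (by simp [insert_subset_iff, hy]), neg_zero]
    · rw [(((partialDeriv_comp_index_of_notMem hFc
        (hnot z hz)).partialDeriv y).partialDeriv x).eq_of_nhds, hzero, hzero,
        if_neg (by simp [insert_subset_iff, hz]), neg_zero]

end PairPotential

/-! ### The cluster poset and its Möbius coefficients. -/

section Clusters

variable {X : Type*} {Wmax : Set (Set X)}

/-- The witness is the intersection of all elements of `Wmax` containing `S`; it is non-empty
because `S` is, as membership in the poset requires. -/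
lemma Covered.exists_minimal_cluster (hW : univ ∉ Wmax) {S : Set X} (hS : S.Nonempty)
    (hc : Covered Wmax S) : ∃ M : ClusterPoset Wmax, M < ⊤ ∧
      ∀ C : ClusterPoset Wmax, C < ⊤ → (S ⊆ C.1 ↔ M ≤ C) := by
  obtain ⟨D, hD, hSD⟩ := hc
  have hSM : S ⊆ ⋂₀ {D ∈ Wmax | S ⊆ D} := subset_sInter fun D hD => hD.2
  refine ⟨⟨⋂₀ {D ∈ Wmax | S ⊆ D}, Or.inr ⟨hS.mono hSM, {D ∈ Wmax | S ⊆ D}, fun _ h => h.1, ⟨D, hD, hSD⟩, rfl⟩⟩,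
    lt_top_iff_ne_top.2 fun h => hW ?_, fun C hC => ⟨fun h => ?_, fun h => hSM.trans h⟩⟩
  -- If the intersection were everything, the covering set `D` would be `univ`, which is not in
  -- `Wmax`.
  · have h' : ⋂₀ {D ∈ Wmax | S ⊆ D} = univ := congrArg Subtype.val h
    rw [← sInter_eq_univ.1 h' D ⟨hD, hSD⟩]
    exact hD
  · rcases C.2 with hu | ⟨-, T, hT, -, hCT⟩
    · exact absurd (Subtype.ext hu) hC.ne
    · change ⋂₀ {D ∈ Wmax | S ⊆ D} ⊆ C.1
      rw [hCT] at h ⊢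
      exact subset_sInter fun D hD => sInter_subset_of_mem ⟨hT hD, h.trans (sInter_subset_of_mem hD)⟩

lemma covered_of_subset_cluster {S : Set X} {C : ClusterPoset Wmax} (hC : C < ⊤) (h : S ⊆ C.1) :
    Covered Wmax S := by
  rcases C.2 with hu | ⟨-, T, hT, ⟨D, hD⟩, hCT⟩
  · exact absurd (Subtype.ext hu) hC.ne
  · exact ⟨D, hT hD, h.trans (hCT ▸ sInter_subset_of_mem hD)⟩

variable [LocallyFiniteOrder (ClusterPoset Wmax)]

/-- The proper clusters through a given site lie in an interval `[M, ⊤]`, which is finite by local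
finiteness; if the site is uncovered there are none. -/
lemma finite_clusters_meeting (hW : univ ∉ Wmax) (Λ : Finset X) :
    {C : ClusterPoset Wmax | C < ⊤ ∧ ∃ x ∈ Λ, x ∈ C.1}.Finite := by
  have : {C : ClusterPoset Wmax | C < ⊤ ∧ ∃ x ∈ Λ, x ∈ C.1} =
      ⋃ x ∈ Λ, {C : ClusterPoset Wmax | C < ⊤ ∧ x ∈ C.1} := by
    ext C
    simp
  rw [this]
  refine Set.Finite.biUnion Λ.finite_toSet fun x _ => ?_
  by_cases hc : Covered Wmax {x}
  · obtain ⟨M, -, h⟩ := hc.exists_minimal_cluster hW (singleton_nonempty x)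
    refine (finite_Icc M ⊤).subset fun C hC => ⟨?_, le_top⟩
    exact (h C hC.1).1 (singleton_subset_iff.2 hC.2)
  · refine Set.finite_empty.subset fun C hC => hc ?_
    exact covered_of_subset_cluster hC.1 (singleton_subset_iff.2 hC.2)

open Classical in
/-- The Möbius coefficients of the clusters containing a given set add up to one if the set is
covered. -/
lemma sum_mu_of_subset (hW : univ ∉ Wmax) {S : Set X} (hS : S.Nonempty)
    (t : Finset (ClusterPoset Wmax)) (ht : ∀ C, C < ⊤ → S ⊆ C.1 → C ∈ t)
    (ht' : ∀ C ∈ t, C < ⊤) (a : ℝ) :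
    ∑ C ∈ t, (-(IncidenceAlgebra.mu ℤ C ⊤ : ℤ) : ℝ) * (if S ⊆ C.1 then a else 0) =
      if Covered Wmax S then a else 0 := by
  split_ifs with hc
  · obtain ⟨M, hM, h⟩ := hc.exists_minimal_cluster hW hS
    -- Since `M ≠ ⊤`, the sum of `μ(C, ⊤)` over `[M, ⊤]` is zero; removing `μ(⊤, ⊤) = 1` leaves `-1`
    -- on `[M, ⊤)`.
    have hmu := IncidenceAlgebra.sum_Icc_mu_left (𝕜 := ℤ) (a := M) (b := ⊤)
    rw [if_neg hM.ne, Finset.Icc_eq_cons_Ico hM.le, Finset.sum_cons,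
      IncidenceAlgebra.mu_self] at hmu
    have hI : {C ∈ t | S ⊆ C.1} = Finset.Ico M ⊤ := by
      ext C
      simp only [Finset.mem_filter, Finset.mem_Ico]
      exact ⟨fun hC => ⟨(h C (ht' C hC.1)).1 hC.2, ht' C hC.1⟩,
        fun hC => ⟨ht C hC.2 ((h C hC.2).2 hC.1), (h C hC.2).2 hC.1⟩⟩
    simp only [mul_ite, mul_zero]
    rw [← Finset.sum_filter, hI, ← Finset.sum_mul, Finset.sum_neg_distrib, ← Int.cast_sum,
      show ∑ C ∈ Finset.Ico M ⊤, IncidenceAlgebra.mu ℤ C ⊤ = -1 by linarith]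
    simp
  · refine Finset.sum_eq_zero fun C hC => ?_
    rw [if_neg fun h => hc (covered_of_subset_cluster (ht' C hC) h), mul_zero]

/-- The low-density expansion of the approximate excess functional. -/
lemma hasLowDensityJet_approxExcessFreeEnergy (V : PairPotential X)
    (hW : univ ∉ Wmax) (Λ : Finset X) :
    HasLowDensityJet (approxExcessFreeEnergy V Wmax) Λ
      (fun x y => if Covered Wmax {x, y} then V.mayer x y else 0)
      (fun x y z => if Covered Wmax {x, y, z} then V.mayerTriangle x y z else 0) := by
  classical
  set t := (finite_clusters_meeting hW Λ).toFinset with ht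
  have hmem (C : ClusterPoset Wmax) : C ∈ t ↔ C < ⊤ ∧ ∃ x ∈ Λ, x ∈ C.1 := by simp [ht]
  have hle (C : ClusterPoset Wmax) (hC : C ∈ t) : C < ⊤ := ((hmem C).1 hC).1
  have hcov {S : Set X} {x : X} (hx : x ∈ Λ) (hxS : x ∈ S) (C : ClusterPoset Wmax) (hC : C < ⊤)
      (hSC : S ⊆ C.1) : C ∈ t := (hmem C).2 ⟨hC, x, hx, hSC hxS⟩
  have hjet := HasLowDensityJet.sum t
    (fun C => (-(IncidenceAlgebra.mu ℤ C ⊤ : ℤ) : ℝ)) fun C _ =>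
      V.hasLowDensityJet_excessFreeEnergy C.1 Λ
  refine hjet.congr ?_ (fun x hx y _ => ?_) (fun x hx y _ z _ => ?_)
  -- Clusters outside `t` miss `Λ` and contribute zero, so the possibly infinite index set reduces
  -- to `t`.
  · filter_upwards [self_mem_nhdsWithin] with v hv
    refine finsum_mem_eq_sum_of_inter_support_eq (s := {C : ClusterPoset Wmax | C < ⊤}) _ ?_
    ext C
    simp only [mem_inter_iff, Function.mem_support, and_congr_left_iff, Finset.mem_coe, hmem]
    refine fun h0 => ⟨fun hC => ⟨hC, ?_⟩, fun hC => hC.1⟩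
    by_contra hno
    push Not at hno
    refine h0 ?_
    rw [V.excessFreeEnergy_eq_zero, mul_zero]
    rw [PairPotential.occupiedSites_profile hv]
    exact Finset.filter_eq_empty_iff.2 hno
  · convert (sum_mu_of_subset hW (insert_nonempty x _) t (hcov hx (mem_insert x _)) hle _).symm
  · convert (sum_mu_of_subset hW (insert_nonempty x _) t (hcov hx (mem_insert x _)) hle _).symm

end Clusters

end

/-! ### Maximal 0D cavities and comparison with the exact functional. -/

lemma ite_eq_left_of_ne_zero {P : Prop} [Decidable P] {a : ℝ} (h : a ≠ 0 → P) :
    (if P then a else 0) = a := by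
  by_cases ha : a = 0
  · simp [ha]
  · rw [if_pos (h ha)]

namespace PairPotential

variable {X : Type*} (V : PairPotential X)

lemma mayerTriangle_rotate (x y z : X) : V.mayerTriangle x y z = V.mayerTriangle z x y := by
  rw [mayerTriangle, mayerTriangle]
  ring

/-- Zorn's lemma applies because being a cavity is a condition on pairs, and any two points of the
union of a chain lie in a common member. -/
lemma IsZeroDCavity.covered {C : Set X} (hC : V.IsZeroDCavity C) :
    Covered V.maximalZeroDCavities C := by
  obtain ⟨M, hCM, hM⟩ := zorn_subset_nonempty {C | V.IsZeroDCavity C}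
    (fun c hc hchain _ => ⟨⋃₀ c, (pairwise_sUnion hchain.directedOn).2 fun s hs => hc hs,
      fun s hs => subset_sUnion_of_mem hs⟩) C hC
  exact ⟨M, hM, hCM⟩

variable {V}

lemma isZeroDCavity_pair {x y : X} (h : V.mayer x y ≠ 0) : V.IsZeroDCavity {x, y} :=
  pairwise_pair.2 fun _ => ⟨h, V.mayer_symm x y ▸ h⟩

variable (V)

lemma covered_of_mayer_ne_zero {x y : X} (h : V.mayer x y ≠ 0) :
    Covered V.maximalZeroDCavities {x, y} :=
  IsZeroDCavity.covered V (isZeroDCavity_pair h)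

lemma covered_of_mayerTriangle_ne_zero {x y z : X} (h : V.mayerTriangle x y z ≠ 0) :
    Covered V.maximalZeroDCavities {x, y, z} := by
  obtain ⟨h', hzx⟩ := mul_ne_zero_iff.1 h
  obtain ⟨hxy, hyz⟩ := mul_ne_zero_iff.1 h'
  refine IsZeroDCavity.covered V ((isZeroDCavity_pair hyz).insert fun w hw _ => ?_)
  rcases hw with rfl | rfl
  · exact ⟨hxy, V.mayer_symm _ _ ▸ hxy⟩
  · exact ⟨V.mayer_symm _ _ ▸ hzx, hzx⟩

/-- The low-density expansion of the exact excess functional of the full cluster. -/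
lemma hasLowDensityJet_univ (Λ : Finset X) :
    HasLowDensityJet (V.excessFreeEnergy univ) Λ V.mayer V.mayerTriangle :=
  (V.hasLowDensityJet_excessFreeEnergy univ Λ).congr (Eventually.of_forall fun _ => rfl)
    (fun _ _ _ _ => by simp) (fun _ _ _ _ _ _ => by simp)

lemma approx_sub_exact_pairDCF_isLittleO {Wmax : Set (Set X)}
    [LocallyFiniteOrder (ClusterPoset Wmax)] (hW : univ ∉ Wmax) {Λ : Finset X} {x y : X}
    (hx : x ∈ Λ) (hy : y ∈ Λ) (h2 : V.mayer x y ≠ 0 → Covered Wmax {x, y})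
    (h3 : ∀ z ∈ Λ, V.mayerTriangle x y z ≠ 0 → Covered Wmax {x, y, z}) :
    (fun v => pairDCF (approxExcessFreeEnergy V Wmax) x y (profile Λ v) -
        pairDCF (V.excessFreeEnergy univ) x y (profile Λ v)) =o[lowDensity Λ] fun v => ‖v‖ := by
  refine (hasLowDensityJet_approxExcessFreeEnergy V hW Λ).sub_pairDCF_isLittleO
    (V.hasLowDensityJet_univ Λ) ⟨x, hx⟩ ⟨y, hy⟩ (ite_eq_left_of_ne_zero h2) fun z =>
    ite_eq_left_of_ne_zero fun h => ?_
  -- The Taylor expansion lists the site of the extra density derivative first, hence the cyclic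
  -- rotation.
  have := h3 z z.2 (by rwa [V.mayerTriangle_rotate])
  rwa [show ({(z : X), x, y} : Set X) = {x, y, (z : X)} by rw [insert_comm, pair_comm]]

end PairPotential

theorem mainTheorem5 {p : ℕ} {L : Type*} (V : PairPotential (Fin p × L)) :
    -- the exact functional, the cluster of the whole lattice
    (∀ Λ : Finset (Fin p × L), SmoothAtLowDensity (V.excessFreeEnergy univ) Λ ∧
      (∀ x ∈ Λ, ∀ y ∈ Λ,
        Tendsto (fun v => pairDCF (V.excessFreeEnergy univ) x y (profile Λ v))
          (lowDensity Λ) (𝓝 (V.mayer x y)) ∧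
        (fun v => pairDCF (V.excessFreeEnergy univ) x y (profile Λ v) - V.pairExpansion Λ x y v)
          =o[lowDensity Λ] fun v => ‖v‖) ∧
      (∀ x ∈ Λ, ∀ y ∈ Λ, ∀ z ∈ Λ,
        Tendsto (fun v => tripletDCF (V.excessFreeEnergy univ) x y z (profile Λ v))
          (lowDensity Λ) (𝓝 (V.mayerTriangle x y z)))) ∧
    -- the approximate functional for a general set of clusters
    (∀ (Wmax : Set (Set (Fin p × L))) [LocallyFiniteOrder (ClusterPoset Wmax)], univ ∉ Wmax →
      (∀ Λ : Finset (Fin p × L), SmoothAtLowDensity (approxExcessFreeEnergy V Wmax) Λ ∧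
        (∀ x ∈ Λ, ∀ y ∈ Λ,
          Tendsto (fun v => pairDCF (approxExcessFreeEnergy V Wmax) x y (profile Λ v))
            (lowDensity Λ) (𝓝 (if Covered Wmax {x, y} then V.mayer x y else 0))) ∧
        (∀ x ∈ Λ, ∀ y ∈ Λ, ∀ z ∈ Λ,
          Tendsto (fun v => tripletDCF (approxExcessFreeEnergy V Wmax) x y z (profile Λ v))
            (lowDensity Λ)
            (𝓝 (if Covered Wmax {x, y, z} then V.mayerTriangle x y z else 0))) ∧
        (∀ x ∈ Λ, ∀ y ∈ Λ, (V.mayer x y ≠ 0 → Covered Wmax {x, y}) →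
          (∀ z ∈ Λ, V.mayerTriangle x y z ≠ 0 → Covered Wmax {x, y, z}) →
          (fun v => pairDCF (approxExcessFreeEnergy V Wmax) x y (profile Λ v) -
              pairDCF (V.excessFreeEnergy univ) x y (profile Λ v))
            =o[lowDensity Λ] fun v => ‖v‖)) ∧
      -- exactness of the zero-density limits
      ((∀ Λ : Finset (Fin p × L), ∀ x ∈ Λ, ∀ y ∈ Λ,
          Tendsto (fun v => pairDCF (approxExcessFreeEnergy V Wmax) x y (profile Λ v) -
              pairDCF (V.excessFreeEnergy univ) x y (profile Λ v)) (lowDensity Λ) (𝓝 0)) ↔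
        ∀ x y, V.mayer x y ≠ 0 → Covered Wmax {x, y}) ∧
      ((∀ Λ : Finset (Fin p × L), ∀ x ∈ Λ, ∀ y ∈ Λ, ∀ z ∈ Λ,
          Tendsto (fun v => tripletDCF (approxExcessFreeEnergy V Wmax) x y z (profile Λ v) -
              tripletDCF (V.excessFreeEnergy univ) x y z (profile Λ v)) (lowDensity Λ) (𝓝 0)) ↔
        ∀ x y z, V.mayerTriangle x y z ≠ 0 → Covered Wmax {x, y, z})) ∧
    -- the choice of the maximal 0D cavities
    (∀ [LocallyFiniteOrder (ClusterPoset V.maximalZeroDCavities)], ¬ V.IsZeroDCavity univ →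
      ∀ Λ : Finset (Fin p × L),
        (∀ x ∈ Λ, ∀ y ∈ Λ,
          (fun v => pairDCF (approxExcessFreeEnergy V V.maximalZeroDCavities) x y (profile Λ v) -
              pairDCF (V.excessFreeEnergy univ) x y (profile Λ v))
            =o[lowDensity Λ] fun v => ‖v‖) ∧
        (∀ x ∈ Λ, ∀ y ∈ Λ, ∀ z ∈ Λ,
          Tendsto (fun v =>
              tripletDCF (approxExcessFreeEnergy V V.maximalZeroDCavities) x y z (profile Λ v) -
              tripletDCF (V.excessFreeEnergy univ) x y z (profile Λ v))
            (lowDensity Λ) (𝓝 0))) := by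
  have hexact (Λ : Finset (Fin p × L)) := V.hasLowDensityJet_univ Λ
  have happ (Wmax : Set (Set (Fin p × L))) [LocallyFiniteOrder (ClusterPoset Wmax)]
      (hW : univ ∉ Wmax) (Λ : Finset (Fin p × L)) :=
    hasLowDensityJet_approxExcessFreeEnergy V hW Λ
  have htriplet (Wmax : Set (Set (Fin p × L))) [LocallyFiniteOrder (ClusterPoset Wmax)]
      (hW : univ ∉ Wmax) (Λ : Finset (Fin p × L)) (x y z : Λ) :=
    ((happ Wmax hW Λ).tendsto_tripletDCF x y z).sub ((hexact Λ).tendsto_tripletDCF x y z)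
  refine ⟨fun Λ => ⟨(hexact Λ).smoothAtLowDensity, fun x hx y hy =>
    ⟨(hexact Λ).tendsto_pairDCF ⟨x, hx⟩ ⟨y, hy⟩, ?_⟩,
    fun x hx y hy z hz => (hexact Λ).tendsto_tripletDCF ⟨x, hx⟩ ⟨y, hy⟩ ⟨z, hz⟩⟩, ?_, ?_⟩
  · refine ((hexact Λ).pairDCF_isLittleO ⟨x, hx⟩ ⟨y, hy⟩).congr_left fun v => ?_
    rw [PairPotential.pairExpansion, mul_add, mul_one, Finset.mul_sum]
    congr 2
    refine Finset.sum_congr rfl fun z _ => ?_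
    rw [PairPotential.mayerTriangle, V.mayer_symm z x, V.mayer_symm z y]
    ring
  · intro Wmax _ hW
    refine ⟨fun Λ => ⟨(happ Wmax hW Λ).smoothAtLowDensity,
      fun x hx y hy => (happ Wmax hW Λ).tendsto_pairDCF ⟨x, hx⟩ ⟨y, hy⟩,
      fun x hx y hy z hz => (happ Wmax hW Λ).tendsto_tripletDCF ⟨x, hx⟩ ⟨y, hy⟩ ⟨z, hz⟩,
      fun x hx y hy => V.approx_sub_exact_pairDCF_isLittleO hW hx hy⟩, ⟨fun h x y hne => ?_, fun h Λ x hx y hy => ?_⟩,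
      ⟨fun h x y z hne => ?_, fun h Λ x hx y hy z hz => ?_⟩⟩
    · classical
      -- The two sites themselves suffice as `Λ`: if they were not covered, the difference would
      -- tend to `-f(x, y)`, and uniqueness of limits would force `f(x, y) = 0`.
      have hx : x ∈ ({x, y} : Finset (Fin p × L)) := by simp
      have hy : y ∈ ({x, y} : Finset (Fin p × L)) := by simp
      have hlim := tendsto_nhds_unique (h _ x hx y hy)
        (((happ Wmax hW _).tendsto_pairDCF ⟨x, hx⟩ ⟨y, hy⟩).sub
          ((hexact _).tendsto_pairDCF ⟨x, hx⟩ ⟨y, hy⟩))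
      by_contra hc
      simp [hc] at hlim
      exact hne hlim
    · have hlim := ((happ Wmax hW Λ).tendsto_pairDCF ⟨x, hx⟩ ⟨y, hy⟩).sub
        ((hexact Λ).tendsto_pairDCF ⟨x, hx⟩ ⟨y, hy⟩)
      rwa [ite_eq_left_of_ne_zero (h x y), sub_self] at hlim
    · classical
      have hx : x ∈ ({x, y, z} : Finset (Fin p × L)) := by simp
      have hy : y ∈ ({x, y, z} : Finset (Fin p × L)) := by simp
      have hz : z ∈ ({x, y, z} : Finset (Fin p × L)) := by simp
      have hlim := tendsto_nhds_unique (h _ x hx y hy z hz)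
        (htriplet Wmax hW _ ⟨x, hx⟩ ⟨y, hy⟩ ⟨z, hz⟩)
      by_contra hc
      simp [hc] at hlim
      exact hne hlim
    · have hlim := htriplet Wmax hW Λ ⟨x, hx⟩ ⟨y, hy⟩ ⟨z, hz⟩
      rwa [ite_eq_left_of_ne_zero (h x y z), sub_self] at hlim
  · intro _ hcav Λ
    -- A maximal cavity is a cavity, which the full lattice is assumed not to be, so the general
    -- results apply.
    have hW : univ ∉ V.maximalZeroDCavities := fun h => hcav h.prop
    refine ⟨fun x hx y hy => V.approx_sub_exact_pairDCF_isLittleO hW hx hy V.covered_of_mayer_ne_zero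
      fun z _ => V.covered_of_mayerTriangle_ne_zero, fun x hx y hy z hz => ?_⟩
    have hlim := htriplet _ hW Λ ⟨x, hx⟩ ⟨y, hy⟩ ⟨z, hz⟩
    rwa [ite_eq_left_of_ne_zero V.covered_of_mayerTriangle_ne_zero, sub_self] at hlim
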